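/- Let $F$ be a field of characteristic $2$, let $V$ be a finite-dimensional $F$-vector space, and let $q:V\to F$ be a quadratic form whose polar form $\mathfrak b_q(x,y)=q(x+y)-q(x)-q(y)$ has zero radical. Let $\tau$ be an isometry of $(V,q)$ with $\tau^2=\mathrm{id}$, and put $\mathrm r(\tau)=\{\tau(x)-x : x\in V\}$ and $\mathrm k(\tau)=\{x\in V : \tau(x)=x\}$. Assume that $\mathrm r(\tau)=\mathrm k(\tau)$. Let $C(q)$ be the Clifford algebra of $q$ and let $J_\tau$ be the $F$-linear involution (anti-automorphism) of $C(q)$ with $J_\tau(v)=\tau(v)$ for $v\in V$. Let $\omega_\tau$ be the Wall form of $\tau$, the bilinear form on $\mathrm r(\tau)$ given by $\omega_\tau(\tau(x)-x,\tau(y)-y)=\mathfrak b_q(\tau(x)-x,y)$, and let $\phi:\mathrm r(\tau)\to F$, $\phi(v)=\omega_\tau(v,v)$, be its associated quadratic form. For an $F$-algebra with involution $(A,\sigma)$ of degree $2^n$ (that is, $\dim_F A=(2^n)^2$), let $\Phi(A,\sigma)$ denote the isomorphism class (when it exists and is unique) of the subalgebras $S\subseteq A$ such that: $\sigma(x)=x$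 and $x^2\in F$ for all $x\in S$; $\dim_F S=2^n$; $S$ is equal to its centralizer in $A$; and $S$ is generated as an $F$-algebra by $n$ elements. Then $$\Phi(C(q),J_\tau)\simeq C(\phi)\simeq C(q|_{\mathrm r(\tau)})$$ as $F$-algebras; that is, such subalgebras $S$ of $(C(q),J_\tau)$ exist, every one of them is isomorphic to $C(\phi)$, and $C(\phi)\simeq C(q|_{\mathrm r(\tau)})$. Moreover, $\phi$ is totally singular (its polar form is zero) and $C(\phi)$ is commutative. -/

import Mathlib

noncomputable section

/-- A quadratic form `q` is regular (so that `(V, q)` is a quadratic space) if the radical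
`V ∩ V^⊥` of its polar form is zero. -/
def RegularForm {F V : Type*} [Field F] [AddCommGroup V] [Module F V]
    (q : QuadraticForm F V) : Prop :=
  ∀ x : V, (∀ y : V, QuadraticMap.polar q x y = 0) → x = 0

/-- A quadratic form is totally singular if its polar form vanishes identically. -/
def TotallySingular {F V : Type*} [Field F] [AddCommGroup V] [Module F V]
    (q : QuadraticForm F V) : Prop :=
  ∀ x y : V, QuadraticMap.polar q x y = 0

/-- An involution of the first kind on an `F`-algebra: an `F`-linear anti-automorphism whose
square is the identity. -/
structure AlgInvolution (F A : Type*) [Field F] [Ring A] [Algebra F A] where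
  toLin : A →ₗ[F] A
  anti_mul : ∀ a b : A, toLin (a * b) = toLin b * toLin a
  involutive : ∀ a : A, toLin (toLin a) = a

/-- `IsPhi σ S` says that the subalgebra `S` of `A` is a representative of the isomorphism class
`Φ(A, σ)`: for `A` of degree `2 ^ n` (that is, of dimension `(2 ^ n) ^ 2`), all elements of `S`
are `σ`-symmetric and have their square in `F`, the dimension of `S` is the degree of `A`,
`S` is its own centralizer in `A`, and `S` is generated by `n` elements. -/
def IsPhi {F A : Type*} [Field F] [Ring A] [Algebra F A]
    (σ : AlgInvolution F A) (S : Subalgebra F A) : Prop :=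
  (∀ x ∈ S, σ.toLin x = x) ∧
  (∀ x ∈ S, ∃ c : F, x ^ 2 = algebraMap F A c) ∧
  Subalgebra.centralizer F (S : Set A) = S ∧
  ∃ n : ℕ, Module.finrank F A = (2 ^ n) ^ 2 ∧ Module.finrank F S = 2 ^ n ∧
    ∃ u : Fin n → A, Algebra.adjoin F (Set.range u) = S

namespace QuadIsometry

variable {F V : Type*} [Field F] [AddCommGroup V] [Module F V] {q : QuadraticForm F V}

/-- The linear map `τ - id`. -/
def subId (τ : q.IsometryEquiv q) : V →ₗ[F] V :=
  (τ.toLinearEquiv : V →ₗ[F] V) - LinearMap.id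

theorem subId_apply (τ : q.IsometryEquiv q) (x : V) : subId τ x = τ x - x := rfl

/-- The residual space `r(τ) = {τ x - x | x ∈ V}`. -/
def residual (τ : q.IsometryEquiv q) : Submodule F V := LinearMap.range (subId τ)

/-- The fixed space `k(τ) = {x | τ x = x}`. -/
def fixed (τ : q.IsometryEquiv q) : Submodule F V := LinearMap.ker (subId τ)

theorem mem_residual (τ : q.IsometryEquiv q) (u : V) :
    u ∈ residual τ ↔ ∃ x : V, τ x - x = u := Iff.rfl

theorem mem_fixed (τ : q.IsometryEquiv q) (x : V) : x ∈ fixed τ ↔ τ x = x := by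
  rw [fixed, LinearMap.mem_ker, subId_apply, sub_eq_zero]

theorem sub_mem_residual (τ : q.IsometryEquiv q) (x : V) : τ x - x ∈ residual τ :=
  ⟨x, rfl⟩

/-- A linear choice, for `u ∈ r(τ)`, of a vector `y` with `τ y - y = u`. -/
def preimage (τ : q.IsometryEquiv q) : residual τ →ₗ[F] V :=
  Classical.choose ((subId τ).rangeRestrict.exists_rightInverse_of_surjective
    (LinearMap.range_rangeRestrict _))

theorem preimage_spec (τ : q.IsometryEquiv q) (u : residual τ) :
    τ (preimage τ u) - preimage τ u = u := by
  have h := Classical.choose_spec ((subId τ).rangeRestrict.exists_rightInverse_of_surjective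
    (LinearMap.range_rangeRestrict _))
  exact congrArg Subtype.val (LinearMap.congr_fun h u)

/-- The Wall form `ω_τ` on `r(τ)`, `ω_τ(u, τ y - y) = b_q(u, y)`. It does not depend on the
choice of `y`; see `wallForm_apply`. -/
def wallForm (τ : q.IsometryEquiv q) : LinearMap.BilinForm F (residual τ) :=
  (QuadraticMap.polarBilin q).compl₁₂ (residual τ).subtype (preimage τ)

theorem polar_map (τ : q.IsometryEquiv q) (x y : V) :
    QuadraticMap.polar q (τ x) (τ y) = QuadraticMap.polar q x y := by
  simp only [QuadraticMap.polar, ← map_add, τ.map_app]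

/-- The defining formula of the Wall form. -/
theorem wallForm_apply (τ : q.IsometryEquiv q) (x y : V) :
    wallForm τ ⟨τ x - x, sub_mem_residual τ x⟩ ⟨τ y - y, sub_mem_residual τ y⟩ =
      QuadraticMap.polar q (τ x - x) y := by
  set z : V := preimage τ ⟨τ y - y, sub_mem_residual τ y⟩ with hz
  have h : τ z - z = τ y - y := preimage_spec τ ⟨τ y - y, sub_mem_residual τ y⟩
  change QuadraticMap.polar q (τ x - x) z = _
  have hk : τ (z - y) = z - y := by
    rw [map_sub]; exact sub_eq_sub_iff_sub_eq_sub.mp h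
  have h0 : QuadraticMap.polar q (τ x - x) (z - y) = 0 := by
    rw [QuadraticMap.polar_sub_left]
    nth_rewrite 1 [← hk]
    rw [polar_map, sub_self]
  rw [QuadraticMap.polar_sub_right, sub_eq_zero] at h0
  exact h0

/-- The quadratic form `v ↦ ω_τ(v, v)` associated with the Wall form. -/
def wallQuadratic (τ : q.IsometryEquiv q) : QuadraticForm F (residual τ) :=
  (wallForm τ).toQuadraticMap

/-- The restriction of `q` to `r(τ)`. -/
def residualForm (τ : q.IsometryEquiv q) : QuadraticForm F (residual τ) :=
  q.comp (residual τ).subtype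

/-- The involution `J_τ` of the Clifford algebra `C(q)` that an isometry `τ` with `τ² = id`
induces: the anti-automorphism with `J_τ(v) = τ(v)` for `v ∈ V`. -/
def cliffordInvolution (τ : q.IsometryEquiv q) (hτ : ∀ x, τ (τ x) = x) :
    AlgInvolution F (CliffordAlgebra q) where
  toLin := CliffordAlgebra.reverse ∘ₗ (CliffordAlgebra.map τ.toIsometry).toLinearMap
  anti_mul a b := by simp
  involutive a := by
    induction a using CliffordAlgebra.induction with
    | algebraMap r => simp
    | ι x => simp [hτ]
    | mul a b ha hb =>
      simp only [LinearMap.comp_apply, AlgHom.toLinearMap_apply, map_mul,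
        CliffordAlgebra.reverse.map_mul] at ha hb ⊢
      rw [ha, hb]
    | add a b ha hb => rw [map_add, map_add, ha, hb]

theorem cliffordInvolution_ι (τ : q.IsometryEquiv q) (hτ : ∀ x, τ (τ x) = x) (v : V) :
    (cliffordInvolution τ hτ).toLin (CliffordAlgebra.ι q v) = CliffordAlgebra.ι q (τ v) := by
  simp [cliffordInvolution]

end QuadIsometry

end

/-! ### Signs in characteristic two -/

section CharTwoModule

/-! For `x` in `V`, both `φ(τx - x)` and `q(τx - x)` equal `b_q(τx, x)`, so `φ` is the restriction
of `q`. Regularity gives `r(τ)^⊥ = k(τ) = r(τ)`. Hence `r(τ)` generates a commutative,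
self-centralizing subalgebra of symmetric elements of `C(q)`, which is a copy of `C(φ)`. This
settles existence; the substance is uniqueness.

Uniqueness rests on squares: two commutative algebras of dimension `2^n`, generated by `n` elements
and with all squares in `F`, are isomorphic once they have the same set of squares
(`nonempty_algEquiv_of_forall_sq_iff`). It thus suffices that the square of any symmetric `t` with
`t^2` in `F` is already a square in any admissible `S` (`exists_sq_eq_of_symmetric`).

For this, put `Alt = {y + σ(y)}` and `Q(b) = σ(b)b` modulo `Alt`. The map `Q` is additive and `Q(xb)
= x^2 Q(b)` for `x` in `S`. Iterated commutators of a suitable `a₀` with the generators of `S` form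
a basis of `A` over `S` whose images under `Q` are independent over `F`. Expanding `1` and `t` in it
and comparing `Q(t) = t^2 Q(1)` gives the claim. Two inputs from `C(q)` are needed: the operators `a
↦ ∑ xᵢ a yᵢ` behave as in a central simple algebra (`eq_zero_of_forall_sum_mul_mul`), and `1` is not
in `Alt` (`one_ne_add_cliffordInvolution`), shown by a `J_τ`-invariant functional with value `1` at
`1`. -/

theorem module_add_self_of_charTwo (F : Type*) {M : Type*} [Field F] [CharP F 2] [AddCommGroup M]
    [Module F M] (x : M) : x + x = 0 := by
  rw [← two_smul F, CharTwo.two_eq_zero, zero_smul]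

theorem module_neg_eq_of_charTwo (F : Type*) {M : Type*} [Field F] [CharP F 2] [AddCommGroup M]
    [Module F M] (x : M) : -x = x :=
  neg_eq_of_add_eq_zero_left (module_add_self_of_charTwo F x)

theorem module_sub_eq_add_of_charTwo (F : Type*) {M : Type*} [Field F] [CharP F 2]
    [AddCommGroup M] [Module F M] (x y : M) : x - y = x + y := by
  rw [sub_eq_add_neg, module_neg_eq_of_charTwo F y]

theorem module_add_eq_zero_iff_of_charTwo (F : Type*) {M : Type*} [Field F] [CharP F 2]
    [AddCommGroup M] [Module F M] {x y : M} : x + y = 0 ↔ x = y := by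
  rw [← module_sub_eq_add_of_charTwo F, sub_eq_zero]

end CharTwoModule

/-! ### Contractions and the subalgebras generated by subspaces -/

namespace CliffordAlgebra

section Field

variable {F V : Type*} [Field F] [AddCommGroup V] [Module F V]

instance nontrivial_of_field (q : QuadraticForm F V) : Nontrivial (CliffordAlgebra q) := by
  obtain ⟨B, hB⟩ := LinearMap.BilinMap.toQuadraticMap_surjective (-q)
  have h : LinearMap.BilinMap.toQuadraticMap B = 0 - q := by rw [hB, zero_sub]
  refine ⟨0, 1, fun h01 => ?_⟩
  have h1 := congrArg (changeForm h) h01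
  rw [map_zero, changeForm_one] at h1
  exact zero_ne_one (α := ExteriorAlgebra F V) h1

/-- The subalgebra of the Clifford algebra generated by a subspace. -/
def adjoinSubmodule (q : QuadraticForm F V) (U : Submodule F V) :
    Subalgebra F (CliffordAlgebra q) :=
  Algebra.adjoin F (ι q '' U)

theorem ι_mem_adjoinSubmodule (q : QuadraticForm F V) {U : Submodule F V} {u : V} (hu : u ∈ U) :
    ι q u ∈ adjoinSubmodule q U :=
  Algebra.subset_adjoin ⟨u, hu, rfl⟩

theorem adjoinSubmodule_top (q : QuadraticForm F V) : adjoinSubmodule q ⊤ = ⊤ := by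
  rw [adjoinSubmodule, Submodule.top_coe, Set.image_univ, adjoin_range_ι]

theorem adjoinSubmodule_bot (q : QuadraticForm F V) : adjoinSubmodule q ⊥ = ⊥ := by
  rw [adjoinSubmodule, Submodule.bot_coe, Set.image_singleton, map_zero,
    Algebra.adjoin_singleton_zero]

theorem adjoinSubmodule_span (q : QuadraticForm F V) (s : Set V) :
    adjoinSubmodule q (Submodule.span F s) = Algebra.adjoin F (ι q '' s) := by
  rw [adjoinSubmodule, ← Submodule.map_coe, Submodule.map_span, Algebra.adjoin_span]

theorem adjoinSubmodule_mono (q : QuadraticForm F V) {U U' : Submodule F V} (h : U ≤ U') :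
    adjoinSubmodule q U ≤ adjoinSubmodule q U' :=
  Algebra.adjoin_mono (Set.image_mono h)

variable {q : QuadraticForm F V}

/-- Contraction recovers `z` from `y + vz`, which makes such decompositions unique. -/
theorem contractLeft_add_ι_mul {d : Module.Dual F V} {v : V} (hd : d v = 1)
    {y z : CliffordAlgebra q} (hy : contractLeft d y = 0) (hz : contractLeft d z = 0) :
    contractLeft d (y + ι q v * z) = z := by
  rw [map_add, hy, contractLeft_ι_mul, hd, hz, one_smul, mul_zero, sub_zero, zero_add]

variable [CharP F 2]

/-- The sign in the antiderivation rule disappears, so contraction is an ordinary derivation. -/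
theorem contractLeft_mul_of_charTwo (d : Module.Dual F V) (x y : CliffordAlgebra q) :
    contractLeft d (x * y) = contractLeft d x * y + x * contractLeft d y := by
  induction x using CliffordAlgebra.left_induction with
  | algebraMap r => rw [contractLeft_algebraMap_mul, contractLeft_algebraMap, zero_mul, zero_add]
  | add a b ha hb => simp only [add_mul, map_add, ha, hb]; abel
  | ι_mul a m ha =>
    rw [mul_assoc, contractLeft_ι_mul, contractLeft_ι_mul, ha,
      module_sub_eq_add_of_charTwo F, module_sub_eq_add_of_charTwo F]
    simp only [mul_add, add_mul, smul_mul_assoc, mul_assoc, add_assoc]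

/-- In characteristic two, commutation with a vector is contraction by its polar functional. -/
theorem ι_mul_add_mul_ι (v : V) (x : CliffordAlgebra q) :
    ι q v * x + x * ι q v = contractLeft (QuadraticMap.polarBilin q v) x := by
  induction x using CliffordAlgebra.left_induction with
  | algebraMap r =>
    rw [contractLeft_algebraMap, Algebra.commutes, module_add_self_of_charTwo F]
  | add a b ha hb => rw [map_add, ← ha, ← hb, mul_add, add_mul]; abel
  | ι_mul a m ha =>
    rw [contractLeft_ι_mul, ← ha, module_sub_eq_add_of_charTwo F, QuadraticMap.polarBilin_apply_apply,
      Algebra.smul_def, ← ι_mul_ι_add_swap, ← module_add_eq_zero_iff_of_charTwo F]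
    simp only [mul_add, add_mul, mul_assoc]
    have h1 := module_add_self_of_charTwo F (ι q v * (ι q m * a))
    have h2 := module_add_self_of_charTwo F (ι q m * (ι q v * a))
    have h3 := module_add_self_of_charTwo F (ι q m * (a * ι q v))
    calc _ = (ι q v * (ι q m * a) + ι q v * (ι q m * a)) +
          (ι q m * (ι q v * a) + ι q m * (ι q v * a)) +
          (ι q m * (a * ι q v) + ι q m * (a * ι q v)) := by abel
      _ = 0 := by rw [h1, h2, h3]; simp

theorem contractLeft_eq_zero_of_mem_adjoinSubmodule {d : Module.Dual F V} {U : Submodule F V}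
    (hU : U ≤ LinearMap.ker d) {x : CliffordAlgebra q} (hx : x ∈ adjoinSubmodule q U) :
    contractLeft d x = 0 := by
  induction hx using Algebra.adjoin_induction with
  | mem x hx =>
    obtain ⟨u, hu, rfl⟩ := hx
    rw [contractLeft_ι, LinearMap.mem_ker.mp (hU hu), map_zero]
  | algebraMap r => exact contractLeft_algebraMap _ _ _
  | add x y _ _ hx hy => rw [map_add, hx, hy, add_zero]
  | mul x y _ _ hx hy => rw [contractLeft_mul_of_charTwo, hx, hy, zero_mul, mul_zero, add_zero]

theorem commutator_mem_adjoinSubmodule (v : V) {U : Submodule F V} {x : CliffordAlgebra q}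
    (hx : x ∈ adjoinSubmodule q U) : x * ι q v + ι q v * x ∈ adjoinSubmodule q U := by
  induction hx using Algebra.adjoin_induction with
  | mem x hx =>
    obtain ⟨u, hu, rfl⟩ := hx
    rw [ι_mul_ι_add_swap]
    exact Subalgebra.algebraMap_mem _ _
  | algebraMap r =>
    rw [Algebra.commutes, module_add_self_of_charTwo F]
    exact zero_mem _
  | add x y _ _ hx hy =>
    have : (x + y) * ι q v + ι q v * (x + y) =
      (x * ι q v + ι q v * x) + (y * ι q v + ι q v * y) := by noncomm_ring
    rw [this]
    exact add_mem hx hy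
  | mul x y hx' hy' hx hy =>
    have h := module_add_self_of_charTwo F (x * ι q v * y)
    have : (x * y) * ι q v + ι q v * (x * y) =
        x * (y * ι q v + ι q v * y) + (x * ι q v + ι q v * x) * y := by
      calc _ = (x * y) * ι q v + ι q v * (x * y) + (x * ι q v * y + x * ι q v * y) := by
            rw [h, add_zero]
        _ = _ := by noncomm_ring
    rw [this]
    exact add_mem (mul_mem hx' hy) (mul_mem hx hy')

/-- Move `v` to the left: its commutators with the algebra of `U ∩ ker d` stay in that algebra, and
`v^2 = q(v)`. -/
theorem exists_add_ι_mul_of_mem_adjoinSubmodule {d : Module.Dual F V} {U : Submodule F V} {v : V}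
    (hv : v ∈ U) (hd : d v = 1) {x : CliffordAlgebra q} (hx : x ∈ adjoinSubmodule q U) :
    ∃ y ∈ adjoinSubmodule q (U ⊓ LinearMap.ker d), ∃ z ∈ adjoinSubmodule q (U ⊓ LinearMap.ker d),
      x = y + ι q v * z := by
  induction hx using Algebra.adjoin_induction with
  | mem x hx =>
    obtain ⟨u, hu, rfl⟩ := hx
    refine ⟨ι q (u - d u • v), ι_mem_adjoinSubmodule q ⟨sub_mem hu (U.smul_mem _ hv), ?_⟩,
      algebraMap F _ (d u), Subalgebra.algebraMap_mem _ _, ?_⟩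
    · simp [hd]
    · rw [← Algebra.commutes, ← Algebra.smul_def, map_sub, map_smul, sub_add_cancel]
  | algebraMap r =>
    exact ⟨algebraMap F _ r, Subalgebra.algebraMap_mem _ _, 0, zero_mem _, by simp⟩
  | add a b _ _ ha hb =>
    obtain ⟨y, hy, z, hz, rfl⟩ := ha
    obtain ⟨y', hy', z', hz', rfl⟩ := hb
    exact ⟨y + y', add_mem hy hy', z + z', add_mem hz hz', by rw [mul_add]; abel⟩
  | mul a b _ _ ha hb =>
    obtain ⟨y, hy, z, hz, rfl⟩ := ha
    obtain ⟨y', hy', z', hz', rfl⟩ := hb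
    have hc := commutator_mem_adjoinSubmodule v hy
    have hc' := commutator_mem_adjoinSubmodule v hz
    set c := y * ι q v + ι q v * y with hcdef
    set c' := z * ι q v + ι q v * z with hcdef'
    have e : y * ι q v = ι q v * y + c := by
      rw [hcdef, add_comm (ι q v * y), add_assoc, module_add_self_of_charTwo F, add_zero]
    have e' : z * ι q v = ι q v * z + c' := by
      rw [hcdef', add_comm (ι q v * z), add_assoc, module_add_self_of_charTwo F, add_zero]
    refine ⟨y * y' + c * z' + algebraMap F _ (q v) * (z * z'),
      add_mem (add_mem (mul_mem hy hy') (mul_mem hc hz'))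
        (mul_mem (Subalgebra.algebraMap_mem _ _) (mul_mem hz hz')),
      y * z' + z * y' + c' * z',
      add_mem (add_mem (mul_mem hy hz') (mul_mem hz hy')) (mul_mem hc' hz'), ?_⟩
    calc (y + ι q v * z) * (y' + ι q v * z') =
          y * y' + (y * ι q v) * z' + ι q v * z * y' + ι q v * (z * ι q v) * z' := by noncomm_ring
      _ = y * y' + (ι q v * y + c) * z' + ι q v * z * y' + ι q v * (ι q v * z + c') * z' := by
          rw [e, e']
      _ = y * y' + c * z' + (ι q v * ι q v) * (z * z') +
          ι q v * (y * z' + z * y' + c' * z') := by noncomm_ring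
      _ = _ := by rw [ι_sq_scalar]

theorem mem_adjoinSubmodule_inf_ker {d : Module.Dual F V} {U : Submodule F V}
    {x : CliffordAlgebra q} (hx : x ∈ adjoinSubmodule q U) (h : contractLeft d x = 0) :
    x ∈ adjoinSubmodule q (U ⊓ LinearMap.ker d) := by
  by_cases hU : U ≤ LinearMap.ker d
  · rwa [inf_eq_left.mpr hU]
  · obtain ⟨v, hv, hdv⟩ := SetLike.not_le_iff_exists.mp hU
    rw [LinearMap.mem_ker] at hdv
    have hd : d ((d v)⁻¹ • v) = 1 := by simp [hdv]
    obtain ⟨y, hy, z, hz, rfl⟩ :=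
      exists_add_ι_mul_of_mem_adjoinSubmodule (U.smul_mem (d v)⁻¹ hv) hd hx
    have h0 := contractLeft_add_ι_mul hd
      (contractLeft_eq_zero_of_mem_adjoinSubmodule inf_le_right hy)
      (contractLeft_eq_zero_of_mem_adjoinSubmodule inf_le_right hz)
    rw [h] at h0
    rwa [← h0, mul_zero, add_zero]

theorem mem_adjoinSubmodule_iInf_ker {κ : Type*} (s : Finset κ) (d : κ → Module.Dual F V)
    {x : CliffordAlgebra q} (h : ∀ i ∈ s, contractLeft (d i) x = 0) :
    x ∈ adjoinSubmodule q (⨅ i ∈ s, LinearMap.ker (d i)) := by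
  classical
  induction s using Finset.induction_on with
  | empty => simp [adjoinSubmodule_top]
  | insert a s ha ih =>
    rw [Finset.iInf_insert, inf_comm]
    exact mem_adjoinSubmodule_inf_ker
      (ih fun i hi => h i (Finset.mem_insert_of_mem hi)) (h a (Finset.mem_insert_self a s))

/-- Induction on `dim U`: if `B` is the algebra of a hyperplane `U ∩ ker d` and `d v = 1`, the
algebra of `U` is `B ⊕ vB`. -/
theorem finite_and_finrank_adjoinSubmodule [FiniteDimensional F V] (U : Submodule F V) :
    Module.Finite F (adjoinSubmodule q U) ∧
      Module.finrank F (adjoinSubmodule q U) = 2 ^ Module.finrank F U := by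
  induction hn : Module.finrank F U generalizing U with
  | zero =>
    rw [Submodule.finrank_eq_zero] at hn
    subst hn
    rw [adjoinSubmodule_bot]
    exact ⟨inferInstance, by rw [Subalgebra.finrank_bot, pow_zero]⟩
  | succ n ih =>
    have hU : U ≠ ⊥ := by rintro rfl; simp at hn
    obtain ⟨v, hv, hv0⟩ := U.ne_bot_iff.mp hU
    obtain ⟨d, hd⟩ := Module.Projective.exists_dual_eq_one F hv0
    have hrank : Module.finrank F ↥(U ⊓ LinearMap.ker d) = n := by
      have h1 := (d ∘ₗ U.subtype).finrank_range_add_finrank_ker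
      have h2 : LinearMap.range (d ∘ₗ U.subtype) = ⊤ := by
        rw [LinearMap.range_eq_top]
        intro c
        exact ⟨c • ⟨v, hv⟩, by simp [hd]⟩
      rw [h2, finrank_top, Module.finrank_self, LinearMap.ker_comp,
        ← Submodule.finrank_map_subtype_eq, Submodule.map_comap_subtype, hn] at h1
      omega
    obtain ⟨hfin, hfr⟩ := ih _ hrank
    set B := adjoinSubmodule q (U ⊓ LinearMap.ker d) with hB
    have hker : ∀ y ∈ B, contractLeft d y = 0 := fun y hy =>
      contractLeft_eq_zero_of_mem_adjoinSubmodule inf_le_right hy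
    let f : (B × B) →ₗ[F] CliffordAlgebra q :=
      LinearMap.coprod B.val.toLinearMap (LinearMap.mulLeft F (ι q v) ∘ₗ B.val.toLinearMap)
    have hf : ∀ p : B × B, f p = p.1 + ι q v * p.2 := fun p => rfl
    have hinj : Function.Injective f := by
      rw [← LinearMap.ker_eq_bot, LinearMap.ker_eq_bot']
      rintro ⟨y, z⟩ h0
      rw [hf] at h0
      have hz := contractLeft_add_ι_mul hd (hker y y.2) (hker z z.2)
      rw [h0, map_zero] at hz
      simp only [← hz, mul_zero, add_zero] at h0
      exact Prod.ext (Subtype.ext h0) (Subtype.ext hz.symm)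
    have hrange : LinearMap.range f = Subalgebra.toSubmodule (adjoinSubmodule q U) := by
      ext x
      constructor
      · rintro ⟨p, rfl⟩
        rw [hf, Subalgebra.mem_toSubmodule]
        exact add_mem (adjoinSubmodule_mono q inf_le_left p.1.2)
          (mul_mem (ι_mem_adjoinSubmodule q hv) (adjoinSubmodule_mono q inf_le_left p.2.2))
      · intro hx
        obtain ⟨y, hy, z, hz, rfl⟩ := exists_add_ι_mul_of_mem_adjoinSubmodule hv hd hx
        exact ⟨(⟨y, hy⟩, ⟨z, hz⟩), rfl⟩
    let e : (B × B) ≃ₗ[F] Subalgebra.toSubmodule (adjoinSubmodule q U) :=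
      (LinearEquiv.ofInjective f hinj).trans (LinearEquiv.ofEq _ _ hrange)
    have h1 := e.finrank_eq
    rw [Module.finrank_prod, hfr] at h1
    exact ⟨Module.Finite.equiv e, by rw [pow_succ, ← Subalgebra.finrank_toSubmodule, ← h1]; ring⟩

theorem finrank_adjoinSubmodule [FiniteDimensional F V] (U : Submodule F V) :
    Module.finrank F (adjoinSubmodule q U) = 2 ^ Module.finrank F U :=
  (finite_and_finrank_adjoinSubmodule U).2

variable (q) in
theorem finite_of_finiteDimensional [FiniteDimensional F V] :
    Module.Finite F (CliffordAlgebra q) := by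
  have h := (finite_and_finrank_adjoinSubmodule (q := q) ⊤).1
  rw [adjoinSubmodule_top] at h
  exact Module.Finite.equiv (Subalgebra.topEquiv (R := F) (A := CliffordAlgebra q)).toLinearEquiv

variable (q) in
theorem finrank_of_charTwo [FiniteDimensional F V] :
    Module.finrank F (CliffordAlgebra q) = 2 ^ Module.finrank F V := by
  have h := finrank_adjoinSubmodule (q := q) ⊤
  rwa [adjoinSubmodule_top, finrank_top, subalgebra_top_finrank_eq_submodule_top_finrank,
    finrank_top] at h

end Field

end CliffordAlgebra

/-- A nonzero subspace stable under finitely many commuting operators of square zero contains a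
nonzero vector annihilated by all of them. -/
theorem exists_ne_zero_forall_apply_eq_zero {F M κ : Type*} [Field F] [AddCommGroup M] [Module F M]
    (θ : κ → Module.End F M) (hcomm : ∀ i j x, θ i (θ j x) = θ j (θ i x))
    (hsq : ∀ i x, θ i (θ i x) = 0) (Z : Submodule F M) (hZ : ∀ i, ∀ x ∈ Z, θ i x ∈ Z)
    (hne : ∃ z ∈ Z, z ≠ 0) (s : Finset κ) : ∃ z ∈ Z, z ≠ 0 ∧ ∀ i ∈ s, θ i z = 0 := by
  classical
  induction s using Finset.induction_on with
  | empty => simpa using hne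
  | insert a s _ ih =>
    obtain ⟨z, hz, hz0, hs⟩ := ih
    by_cases h : θ a z = 0
    · exact ⟨z, hz, hz0, by simpa [h] using hs⟩
    · refine ⟨θ a z, hZ a z hz, h, fun i hi => ?_⟩
      rcases Finset.mem_insert.mp hi with rfl | hi
      · exact hsq i z
      · rw [hcomm, hs i hi, map_zero]

/-! ### Two-sided multiplications and centralizers in Clifford algebras -/

namespace CliffordAlgebra

variable {F V : Type*} [Field F] [CharP F 2] [AddCommGroup V] [Module F V]
  {q : QuadraticForm F V}

theorem polarBilin_contractLeft_comm (v w : V) (x : CliffordAlgebra q) :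
    contractLeft (QuadraticMap.polarBilin q v) (contractLeft (QuadraticMap.polarBilin q w) x) =
      contractLeft (QuadraticMap.polarBilin q w) (contractLeft (QuadraticMap.polarBilin q v) x) := by
  rw [contractLeft_comm, module_neg_eq_of_charTwo F]

/-- An element killed by these contractions lies in the algebra generated by their common kernel,
which is the radical of the polar form. -/
theorem mem_bot_of_forall_contractLeft [FiniteDimensional F V] (hq : RegularForm q) {κ : Type*}
    [Fintype κ] (b : Module.Basis κ F V) {x : CliffordAlgebra q}
    (h : ∀ i, contractLeft (QuadraticMap.polarBilin q (b i)) x = 0) :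
    x ∈ (⊥ : Subalgebra F (CliffordAlgebra q)) := by
  have hx := mem_adjoinSubmodule_iInf_ker Finset.univ
    (fun i => QuadraticMap.polarBilin q (b i)) (fun i _ => h i)
  have hbot : (⨅ i ∈ (Finset.univ : Finset κ), LinearMap.ker (QuadraticMap.polarBilin q (b i))) =
      ⊥ := by
    rw [Submodule.eq_bot_iff]
    intro v hv
    simp only [Finset.mem_univ, iInf_pos, Submodule.mem_iInf, LinearMap.mem_ker,
      QuadraticMap.polarBilin_apply_apply] at hv
    refine hq v fun y => ?_
    have : (QuadraticMap.polarBilin q).flip v = 0 := b.ext fun i => by simpa using hv i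
    rw [QuadraticMap.polar_comm]
    simpa using LinearMap.congr_fun this y
  rwa [hbot, adjoinSubmodule_bot] at hx

/-- The multiplication operators `a ↦ ∑ xᵢ a yᵢ` of a regular Clifford algebra determine the
coefficients `xᵢ` when the `yᵢ` are linearly independent. -/
theorem eq_zero_of_forall_sum_mul_mul [FiniteDimensional F V] (hq : RegularForm q) {κ : Type*}
    [Fintype κ] {y : κ → CliffordAlgebra q} (hy : LinearIndependent F y)
    {x : κ → CliffordAlgebra q} (h : ∀ a, ∑ i, x i * a * y i = 0) : x = 0 := by
  let Z : Submodule F (κ → CliffordAlgebra q) :=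
    { carrier := {x | ∀ a, ∑ i, x i * a * y i = 0}
      zero_mem' := by simp
      add_mem' := fun {x x'} hx hx' a => by
        simp only [Pi.add_apply, add_mul, Finset.sum_add_distrib, hx a, hx' a, add_zero]
      smul_mem' := fun c x hx a => by
        simp only [Pi.smul_apply, smul_mul_assoc, ← Finset.smul_sum, hx a, smul_zero] }
  have hZ : ∀ z, z ∈ Z ↔ ∀ a, ∑ i, z i * a * y i = 0 := fun z => Iff.rfl
  by_contra hx0
  let b := Module.finBasis F V
  let θ : Fin (Module.finrank F V) → Module.End F (κ → CliffordAlgebra q) := fun j =>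
    LinearMap.pi fun i => contractLeft (QuadraticMap.polarBilin q (b j)) ∘ₗ LinearMap.proj i
  have hθ : ∀ j z i, θ j z i = contractLeft (QuadraticMap.polarBilin q (b j)) (z i) :=
    fun _ _ _ => rfl
  obtain ⟨z, hz, hz0, hk⟩ := exists_ne_zero_forall_apply_eq_zero θ
    (fun i j z => funext fun k => by simp only [hθ, polarBilin_contractLeft_comm])
    (fun i z => funext fun k => by simp only [hθ, contractLeft_contractLeft, Pi.zero_apply]) Z
    -- Contraction is the commutator with `ι q (b j)`, so stability of `Z` follows by replacing `a`
    -- with `ι q (b j) * a` and by multiplying the relation on the left.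
    (fun j z hz a => by
      have h1 := hz (ι q (b j) * a)
      have h2 := congrArg (fun t => ι q (b j) * t) (hz a)
      simp only [mul_zero, Finset.mul_sum] at h2
      simp only [hθ, ← ι_mul_add_mul_ι, add_mul, mul_assoc, Finset.sum_add_distrib] at h1 h2 ⊢
      rw [h1, h2, add_zero]) ⟨x, h, hx0⟩ Finset.univ
  -- A tuple killed by all contractions is scalar; `a = 1` then gives a linear relation among the `y
  -- i`.
  have hscalar : ∀ i, ∃ c : F, algebraMap F _ c = z i := fun i =>
    Algebra.mem_bot.mp (mem_bot_of_forall_contractLeft hq b fun j => by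
      rw [← hθ, hk j (Finset.mem_univ j), Pi.zero_apply])
  choose c hc using hscalar
  have h1 := (hZ z).mp hz 1
  simp only [mul_one, ← hc, ← Algebra.smul_def] at h1
  refine hz0 (funext fun i => ?_)
  rw [← hc i, Fintype.linearIndependent_iff.mp hy c h1 i, map_zero, Pi.zero_apply]

/-- The Clifford algebra of the restriction of `q` to a subspace is the subalgebra generated by
that subspace. -/
theorem nonempty_algEquiv_adjoinSubmodule [FiniteDimensional F V] (q : QuadraticForm F V)
    (U : Submodule F V) :
    Nonempty (CliffordAlgebra (q.comp U.subtype) ≃ₐ[F] adjoinSubmodule q U) := by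
  let i : q.comp U.subtype →qᵢ q := { U.subtype with map_app' := fun _ => rfl }
  have hi : ∀ u : U, i u = u := fun _ => rfl
  have hrange : (CliffordAlgebra.map i).range = adjoinSubmodule q U := by
    rw [← Algebra.map_top, ← adjoin_range_ι, AlgHom.map_adjoin, adjoinSubmodule]
    congr 1
    ext x
    simp [hi]
  let f := (CliffordAlgebra.map i).rangeRestrict
  have hsurj : Function.Surjective f := AlgHom.rangeRestrict_surjective _
  have := finite_of_finiteDimensional (q.comp U.subtype)
  have := Module.Finite.of_surjective f.toLinearMap hsurj
  have hfr : Module.finrank F (CliffordAlgebra (q.comp U.subtype)) =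
      Module.finrank F (CliffordAlgebra.map i).range := by
    rw [finrank_of_charTwo, hrange, finrank_adjoinSubmodule]
  have hinj : Function.Injective f :=
    (LinearMap.injective_iff_surjective_of_finrank_eq_finrank (f := f.toLinearMap) hfr).mpr hsurj
  exact ⟨(AlgEquiv.ofBijective f ⟨hinj, hsurj⟩).trans (Subalgebra.equivOfEq _ _ hrange)⟩

theorem commute_of_mem_adjoinSubmodule {U : Submodule F V}
    (hU : ∀ u ∈ U, ∀ v ∈ U, QuadraticMap.polar q u v = 0) {x y : CliffordAlgebra q}
    (hx : x ∈ adjoinSubmodule q U) (hy : y ∈ adjoinSubmodule q U) : x * y = y * x := by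
  refine Algebra.commute_of_mem_adjoin_of_forall_mem_commute hy (fun b hb => ?_)
  refine (Algebra.commute_of_mem_adjoin_of_forall_mem_commute hx (fun a ha => ?_)).symm
  obtain ⟨u, hu, rfl⟩ := ha
  obtain ⟨v, hv, rfl⟩ := hb
  have h := ι_mul_ι_add_swap (Q := q) u v
  rw [hU u hu v hv, map_zero, module_add_eq_zero_iff_of_charTwo F] at h
  exact h.symm

theorem sq_mem_bot_of_mem_adjoinSubmodule {U : Submodule F V}
    (hU : ∀ u ∈ U, ∀ v ∈ U, QuadraticMap.polar q u v = 0) {x : CliffordAlgebra q}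
    (hx : x ∈ adjoinSubmodule q U) : ∃ c : F, x ^ 2 = algebraMap F _ c := by
  induction hx using Algebra.adjoin_induction with
  | mem x hx =>
    obtain ⟨u, _, rfl⟩ := hx
    exact ⟨q u, by rw [sq, ι_sq_scalar]⟩
  | algebraMap r => exact ⟨r ^ 2, by rw [map_pow]⟩
  | add x y hx hy ihx ihy =>
    obtain ⟨c, hc⟩ := ihx
    obtain ⟨c', hc'⟩ := ihy
    refine ⟨c + c', ?_⟩
    rw [map_add, ← hc, ← hc', (show Commute x y from commute_of_mem_adjoinSubmodule hU hx hy).add_sq,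
      mul_assoc, two_mul, module_add_self_of_charTwo F, add_zero]
  | mul x y hx hy ihx ihy =>
    obtain ⟨c, hc⟩ := ihx
    obtain ⟨c', hc'⟩ := ihy
    refine ⟨c * c', ?_⟩
    rw [map_mul, ← hc, ← hc', (show Commute x y from commute_of_mem_adjoinSubmodule hU hx hy).mul_pow]

/-- Commuting with `u` means being killed by contraction with `b_q(u, ·)`. Hence `x` lies in the
algebra of `U^⊥`, and the hypothesis says `U^⊥ ≤ U`. -/
theorem mem_adjoinSubmodule_of_forall_commute [FiniteDimensional F V] {U : Submodule F V}
    (hU : ∀ x, (∀ u ∈ U, QuadraticMap.polar q u x = 0) → x ∈ U) {x : CliffordAlgebra q}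
    (hx : ∀ u ∈ U, ι q u * x = x * ι q u) : x ∈ adjoinSubmodule q U := by
  obtain ⟨s, hs⟩ := IsNoetherian.noetherian U
  have h1 := mem_adjoinSubmodule_iInf_ker s (QuadraticMap.polarBilin q) (x := x) fun u hu => by
    rw [← ι_mul_add_mul_ι, module_add_eq_zero_iff_of_charTwo F]
    exact hx u (hs ▸ Submodule.subset_span hu)
  refine adjoinSubmodule_mono q (fun v hv => hU v fun u hu => ?_) h1
  simp only [Submodule.mem_iInf, LinearMap.mem_ker] at hv
  rw [← hs] at hu
  induction hu using Submodule.span_induction with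
  | mem u hu => exact hv u hu
  | zero => exact QuadraticMap.polar_zero_left q v
  | add a b _ _ ha hb => rw [QuadraticMap.polar_add_left, ha, hb, add_zero]
  | smul c a _ ha => rw [QuadraticMap.polar_smul_left, ha, smul_zero]

end CliffordAlgebra

/-! ### Residual space, Wall form and existence -/

namespace QuadIsometry

open CliffordAlgebra

variable {F V : Type*} [Field F] [AddCommGroup V] [Module F V] {q : QuadraticForm F V}

theorem polar_residual_fixed (τ : q.IsometryEquiv q) {u x : V} (hu : u ∈ residual τ)
    (hx : x ∈ fixed τ) : QuadraticMap.polar q u x = 0 := by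
  obtain ⟨y, rfl⟩ := (mem_residual τ u).mp hu
  rw [QuadraticMap.polar_sub_left]
  nth_rewrite 1 [← (mem_fixed τ x).mp hx]
  rw [polar_map, sub_self]

/-- `b(τx - x, τz) = b(x, z) - b(x, τz) = -b(x, τz - z)` vanishes for all `z`, and `τ` is onto. -/
theorem mem_fixed_of_forall_polar (hq : RegularForm q) (τ : q.IsometryEquiv q) {x : V}
    (hx : ∀ u ∈ residual τ, QuadraticMap.polar q u x = 0) : x ∈ fixed τ := by
  rw [mem_fixed, ← sub_eq_zero]
  refine hq _ fun y => ?_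
  obtain ⟨z, rfl⟩ : ∃ z, τ z = y := τ.surjective y
  have h := hx _ (sub_mem_residual τ z)
  rw [QuadraticMap.polar_sub_left, sub_eq_zero] at h
  rw [QuadraticMap.polar_sub_left, polar_map, QuadraticMap.polar_comm q x (τ z), h,
    QuadraticMap.polar_comm, sub_self]

theorem polar_eq_zero_of_mem_residual {τ : q.IsometryEquiv q} (hrk : residual τ = fixed τ) {u v : V}
    (hu : u ∈ residual τ) (hv : v ∈ residual τ) : QuadraticMap.polar q u v = 0 :=
  polar_residual_fixed τ hu (hrk ▸ hv)

variable [CharP F 2]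

/-- Both sides at `τx - x` equal `b_q(τx, x)`: the multiples of `2 q(x)` vanish. -/
theorem wallQuadratic_eq_residualForm (τ : q.IsometryEquiv q) :
    wallQuadratic τ = residualForm τ := by
  ext ⟨u, hu⟩
  obtain ⟨x, rfl⟩ := (mem_residual τ u).mp hu
  have h1 := wallForm_apply τ x x
  change wallForm τ _ _ = q (τ x - x)
  rw [h1, QuadraticMap.polar_sub_left, QuadraticMap.polar_self,
    module_sub_eq_add_of_charTwo F (τ x) x, QuadraticMap.map_add q (τ x) x, τ.map_app, two_nsmul,
    CharTwo.add_self_eq_zero, sub_zero, zero_add]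

/-- The residual space is its own orthogonal, so its algebra is commutative and self-centralizing;
rank-nullity gives `dim V = 2 dim r(τ)`. -/
theorem isPhi_adjoinSubmodule_residual [FiniteDimensional F V] (hq : RegularForm q)
    (τ : q.IsometryEquiv q) (hτ : ∀ x, τ (τ x) = x) (hrk : residual τ = fixed τ) :
    IsPhi (cliffordInvolution τ hτ) (adjoinSubmodule q (residual τ)) := by
  have hU : ∀ u ∈ residual τ, ∀ v ∈ residual τ, QuadraticMap.polar q u v = 0 :=
    fun u hu v hv => polar_eq_zero_of_mem_residual hrk hu hv
  refine ⟨fun x hx => ?_, fun x hx => sq_mem_bot_of_mem_adjoinSubmodule hU hx, ?_,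
    Module.finrank F (residual τ), ?_, finrank_adjoinSubmodule _,
    fun i => ι q (Module.finBasis F (residual τ) i), ?_⟩
  · induction hx using Algebra.adjoin_induction with
    | mem x hx =>
      obtain ⟨u, hu, rfl⟩ := hx
      rw [cliffordInvolution_ι, (mem_fixed τ u).mp (hrk ▸ hu)]
    | algebraMap r => simp [cliffordInvolution]
    | add x y _ _ hx hy => rw [map_add, hx, hy]
    | mul x y hx' hy' hx hy =>
      rw [AlgInvolution.anti_mul, hx, hy, commute_of_mem_adjoinSubmodule hU hx' hy']
  · ext x
    rw [Subalgebra.mem_centralizer_iff]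
    refine ⟨fun hx => mem_adjoinSubmodule_of_forall_commute
      (fun y hy => hrk ▸ mem_fixed_of_forall_polar hq τ hy)
      fun u hu => hx _ (ι_mem_adjoinSubmodule q hu), fun hx y hy =>
        commute_of_mem_adjoinSubmodule hU hy hx⟩
  · have h := (subId τ).finrank_range_add_finrank_ker
    change Module.finrank F (residual τ) + Module.finrank F (fixed τ) = _ at h
    rw [← hrk] at h
    rw [finrank_of_charTwo, ← h, ← pow_mul, mul_two]
  · have h := (Module.finBasis F (residual τ)).span_eq
    have h' : residual τ = Submodule.span F
        (Set.range fun i => (Module.finBasis F (residual τ) i : V)) := by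
      have h2 := congrArg (Submodule.map (residual τ).subtype) h
      rw [Submodule.map_span, Submodule.map_subtype_top, ← Set.range_comp] at h2
      exact h2.symm
    conv_rhs => rw [h', adjoinSubmodule_span, ← Set.range_comp]
    rfl

end QuadIsometry

/-! ### Functionals with Wick's recursion -/

namespace CliffordAlgebra

variable {F V : Type*} [Field F] [AddCommGroup V] [Module F V] {q : QuadraticForm F V}

/-- Uniqueness for Wick's recursion. Transported to the exterior algebra by `changeForm`, the
recursion says that `g` kills every product `ι m * a`. -/
theorem eq_zero_of_forall_ι_mul {B : LinearMap.BilinForm F V} (hB : ∀ x, B x x = q x)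
    {g : CliffordAlgebra q →ₗ[F] F} (h1 : g 1 = 0)
    (hg : ∀ v x, g (ι q v * x) = g (contractLeft (B v) x)) : g = 0 := by
  have h : LinearMap.BilinMap.toQuadraticMap B = q - 0 := by
    ext x
    simp [hB]
  have key : ∀ y : CliffordAlgebra (0 : QuadraticForm F V), g (changeForm h y) = 0 := fun y => by
    induction y using CliffordAlgebra.left_induction with
    | algebraMap r =>
      rw [changeForm_algebraMap, Algebra.algebraMap_eq_smul_one, map_smul, h1, smul_zero]
    | add a b ha hb => rw [map_add, map_add, ha, hb, add_zero]
    | ι_mul a m ha => rw [changeForm_ι_mul, map_sub, hg, sub_self]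
  ext x
  obtain ⟨y, rfl⟩ := (changeFormEquiv h).surjective x
  exact key y

variable [CharP F 2]

/-- A bilinear form whose quadratic form is `q` extends to a linear functional on the Clifford
algebra with Wick's recursion. -/
theorem exists_functional_of_toQuadraticMap_eq {B : LinearMap.BilinForm F V}
    (hB : ∀ x, B x x = q x) :
    ∃ f : CliffordAlgebra q →ₗ[F] F, f 1 = 1 ∧
      (∀ v x, f (ι q v * x) = f (contractLeft (B v) x)) ∧
      ∀ v x, f (x * ι q v) = f (contractLeft (B.flip v) x) := by
  have h : LinearMap.BilinMap.toQuadraticMap B = 0 - q := by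
    ext x
    simp [hB, CharTwo.neg_eq]
  let f : CliffordAlgebra q →ₗ[F] F :=
    (ExteriorAlgebra.algebraMapInv (R := F) (M := V)).toLinearMap ∘ₗ changeForm h
  have hf : ∀ x, f x = ExteriorAlgebra.algebraMapInv (changeForm h x) := fun _ => rfl
  have hleft : ∀ v x, f (ι q v * x) = f (contractLeft (B v) x) := fun v x => by
    rw [hf, hf, changeForm_ι_mul, changeForm_contractLeft, map_sub, map_mul]
    have : ExteriorAlgebra.algebraMapInv (ι (0 : QuadraticForm F V) v) = 0 :=
      (CliffordAlgebra.lift_ι_apply _ _ v).trans rfl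
    rw [this, zero_mul, zero_sub, CharTwo.neg_eq]
  refine ⟨f, ?_, hleft, fun v x => ?_⟩
  · rw [hf, changeForm_one, map_one]
  -- The right-hand recursion follows from the left one, since commutation with `v` is contraction
  -- by `b_q(v, ·) = B(v, ·) + B(·, v)`.
  · have hpol : QuadraticMap.polarBilin q v = B v + B.flip v := by
      ext w
      simp only [QuadraticMap.polarBilin_apply_apply, QuadraticMap.polar, ← hB, map_add,
        LinearMap.add_apply, LinearMap.BilinForm.flip_apply]
      simp only [CharTwo.sub_eq_add]
      have h1 := CharTwo.add_self_eq_zero (B v v)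
      have h2 := CharTwo.add_self_eq_zero (B w w)
      linear_combination h1 + h2
    have h1 := congrArg f (ι_mul_add_mul_ι v x)
    rw [map_add, hleft, hpol, map_add, LinearMap.add_apply, map_add] at h1
    exact add_left_cancel h1

end CliffordAlgebra

/-! ### An invariant functional and the non-alternating identity -/

namespace QuadIsometry

open CliffordAlgebra

variable {F V : Type*} [Field F] [AddCommGroup V] [Module F V] {q : QuadraticForm F V}

theorem wallForm_comm (τ : q.IsometryEquiv q) (hτ : ∀ x, τ (τ x) = x) (u v : residual τ) :
    wallForm τ u v = wallForm τ v u := by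
  obtain ⟨_, a, rfl⟩ := u
  obtain ⟨_, b, rfl⟩ := v
  refine (wallForm_apply τ a b).trans (Eq.trans ?_ (wallForm_apply τ b a).symm)
  rw [QuadraticMap.polar_sub_left, QuadraticMap.polar_sub_left, QuadraticMap.polar_comm q a b,
    ← polar_map τ (τ a) b, hτ, QuadraticMap.polar_comm q a (τ b)]

theorem preimage_subId_sub_mem_fixed (τ : q.IsometryEquiv q) (x : V) :
    x - preimage τ ⟨τ x - x, sub_mem_residual τ x⟩ ∈ fixed τ := by
  have h := preimage_spec τ ⟨τ x - x, sub_mem_residual τ x⟩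
  rw [mem_fixed, map_sub]
  simp only at h
  rw [sub_eq_sub_iff_sub_eq_sub, h]

variable [CharP F 2]

/-- Write `x = r x + s(N x)` with `N = τ - id`, `s` a section of `N`, and `r x` in `k(τ) = r(τ)`.
With `p` a bilinear form representing `q` on the image of `s`, take `h(x, y) = ω(r x, r y) + p(r x,
N y) + p(r y, N x)`. Since `N τ = N` and `r τ = r + N`, `h(τx, x)` is `q(r x) + b_q(r x, s(N x)) +
q(s(N x))`. -/
theorem exists_symm_bilinForm (τ : q.IsometryEquiv q) (hτ : ∀ x, τ (τ x) = x)
    (hrk : residual τ = fixed τ) :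
    ∃ h : LinearMap.BilinForm F V, (∀ x y, h x y = h y x) ∧ ∀ x, h (τ x) x = q x := by
  obtain ⟨P, hP⟩ := LinearMap.BilinMap.toQuadraticMap_surjective q
  have hP : ∀ x, P x x = q x := fun x => by rw [← hP]; rfl
  let N : V →ₗ[F] residual τ := (subId τ).rangeRestrict
  have hN : ∀ x, (N x : V) = τ x - x := fun _ => rfl
  let r : V →ₗ[F] residual τ := (LinearMap.id - preimage τ ∘ₗ N).codRestrict _
    fun x => hrk.ge (preimage_subId_sub_mem_fixed τ x)
  have hr : ∀ x, (r x : V) = x - preimage τ (N x) := fun _ => rfl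
  let p : LinearMap.BilinForm F (residual τ) := P.compl₁₂ (preimage τ) (preimage τ)
  have hp : ∀ u v, p u v = P (preimage τ u) (preimage τ v) := fun _ _ => rfl
  refine ⟨(wallForm τ).compl₁₂ r r + p.compl₁₂ r N + (p.compl₁₂ r N).flip, fun x y => ?_,
    fun x => ?_⟩
  · simp only [LinearMap.add_apply, LinearMap.compl₁₂_apply, LinearMap.flip_apply]
    rw [wallForm_comm τ hτ (r x)]
    ring
  · have hNτ : N (τ x) = N x := Subtype.ext <| by
      rw [hN, hN, hτ, ← neg_sub, module_neg_eq_of_charTwo F]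
    have hrτ : r (τ x) = r x + N x := Subtype.ext <| by
      rw [Submodule.coe_add, hr, hr, hN, hNτ]
      abel
    have hω : wallForm τ (r x) (r x) = q (r x) :=
      congrArg (fun Q => Q (r x)) (wallQuadratic_eq_residualForm τ)
    have hω' : wallForm τ (r x) (N x) = QuadraticMap.polar q (r x) (preimage τ (N x)) := rfl
    have hx : x = r x + preimage τ (N x) := by rw [hr, sub_add_cancel]
    simp only [LinearMap.add_apply, LinearMap.compl₁₂_apply, LinearMap.flip_apply]
    rw [hNτ, hrτ, map_add, map_add, LinearMap.add_apply, LinearMap.add_apply,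
      wallForm_comm τ hτ (N x), hω, hω', hp (N x), hP]
    conv_rhs => rw [hx, QuadraticMap.map_add q (r x : V)]
    linear_combination CharTwo.add_self_eq_zero (p (r x) (N x))

/-- The identity is not of the form `x + J_τ(x)`. -/
theorem one_ne_add_cliffordInvolution (τ : q.IsometryEquiv q) (hτ : ∀ x, τ (τ x) = x)
    (hrk : residual τ = fixed τ) (x : CliffordAlgebra q) :
    x + (cliffordInvolution τ hτ).toLin x ≠ 1 := by
  obtain ⟨h, hsymm, hdiag⟩ := exists_symm_bilinForm τ hτ hrk
  -- Twisting `h` by `τ` makes `q` the diagonal of `B`. The symmetry of `h` becomes the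
  -- compatibility `hflip`, by which `f ∘ σ` obeys the same recursion as `f`.
  let B : LinearMap.BilinForm F V := h ∘ₗ (τ.toLinearEquiv : V →ₗ[F] V)
  have hB : ∀ x y, B x y = h (τ x) y := fun _ _ => rfl
  obtain ⟨f, hf1, hfl, hfr⟩ := exists_functional_of_toQuadraticMap_eq (B := B) hdiag
  set σ := (cliffordInvolution τ hτ).toLin with hσ
  have hσmul : ∀ a b, σ (a * b) = σ b * σ a := (cliffordInvolution τ hτ).anti_mul
  have hσι : ∀ v, σ (ι q v) = ι q (τ v) := cliffordInvolution_ι τ hτ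
  have hσalg : ∀ r, σ (algebraMap F _ r) = algebraMap F _ r := fun r => by
    simp [hσ, cliffordInvolution]
  have hcontr : ∀ (d : Module.Dual F V) y, σ (contractLeft (d ∘ₗ (τ.toLinearEquiv : V →ₗ[F] V)) y) =
      contractLeft d (σ y) := fun d y => by
    induction y using CliffordAlgebra.left_induction with
    | algebraMap r => rw [contractLeft_algebraMap, hσalg, contractLeft_algebraMap, map_zero]
    | add a b ha hb => rw [map_add, map_add, ha, hb, map_add, map_add]
    | ι_mul a m ha =>
      rw [contractLeft_ι_mul, hσmul, contractLeft_mul_of_charTwo, map_sub, map_smul, hσmul, ha,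
        hσι, contractLeft_ι, ← Algebra.commutes, ← Algebra.smul_def,
        module_sub_eq_add_of_charTwo F, add_comm]
      rfl
  have hfσ : f ∘ₗ σ = f := by
    refine sub_eq_zero.mp (eq_zero_of_forall_ι_mul hdiag (B := B) ?_ fun v y => ?_)
    · rw [LinearMap.sub_apply, LinearMap.comp_apply, ← map_one (algebraMap F (CliffordAlgebra q)),
        hσalg, sub_self]
    · have hflip : B v = B.flip (τ v) ∘ₗ (τ.toLinearEquiv : V →ₗ[F] V) := by
        ext y
        change h (τ v) y = h (τ (τ y)) (τ v)
        rw [hτ, hsymm]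
      rw [LinearMap.sub_apply, LinearMap.sub_apply, LinearMap.comp_apply, LinearMap.comp_apply,
        hfl, hσmul, hσι, hfr, ← hcontr, ← hflip]
  intro hx
  -- Invariance gives `f (x + σ x) = 2 f x = 0`, whereas `f 1 = 1`.
  have h1 := congrArg f hx
  rw [map_add, ← LinearMap.comp_apply f σ, hfσ, CharTwo.add_self_eq_zero, hf1] at h1
  exact zero_ne_one h1

end QuadIsometry

/-! ### Squarefree monomials and independence by insertion operators -/

section Monomials

variable {F S ι : Type*} [Field F] [CommRing S] [Algebra F S] [DecidableEq ι]

theorem span_range_prod_eq_top {u : ι → S} (hu : Algebra.adjoin F (Set.range u) = ⊤)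
    (hsq : ∀ i, ∃ c : F, u i ^ 2 = algebraMap F S c) :
    Submodule.span F (Set.range fun s : Finset ι => ∏ i ∈ s, u i) = ⊤ := by
  set P := Submodule.span F (Set.range fun s : Finset ι => ∏ i ∈ s, u i) with hP
  have hmem : ∀ s : Finset ι, ∏ i ∈ s, u i ∈ P := fun s => Submodule.subset_span ⟨s, rfl⟩
  have hmul : ∀ i, ∀ x ∈ P, u i * x ∈ P := fun i x hx => by
    induction hx using Submodule.span_induction with
    | mem x hx =>
      obtain ⟨s, rfl⟩ := hx
      by_cases his : i ∈ s
      · obtain ⟨c, hc⟩ := hsq i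
        have := P.smul_mem c (hmem (s.erase i))
        rwa [Algebra.smul_def, ← hc, sq, mul_assoc, Finset.mul_prod_erase s u his] at this
      · have := hmem (insert i s)
        rwa [Finset.prod_insert his] at this
    | zero => rw [mul_zero]; exact zero_mem _
    | add x y _ _ hx hy => rw [mul_add]; exact add_mem hx hy
    | smul c x _ hx => rw [mul_smul_comm]; exact P.smul_mem c hx
  rw [eq_top_iff, ← Algebra.top_toSubmodule, ← hu, Algebra.adjoin_eq_span, Submodule.span_le]
  intro x hx
  induction hx using Submonoid.closure_induction_left with
  | one => simpa using hmem ∅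
  | mul_left x hx y _ hy =>
    obtain ⟨i, rfl⟩ := hx
    exact hmul i y hy

theorem linearIndependent_prod [Fintype ι] {u : ι → S} (hu : Algebra.adjoin F (Set.range u) = ⊤)
    (hsq : ∀ i, ∃ c : F, u i ^ 2 = algebraMap F S c)
    (hrank : Module.finrank F S = 2 ^ Fintype.card ι) :
    LinearIndependent F fun s : Finset ι => ∏ i ∈ s, u i :=
  linearIndependent_of_top_le_span_of_card_eq_finrank (span_range_prod_eq_top hu hsq).ge
    (by rw [Fintype.card_finset, hrank])

end Monomials

/-- A family indexed by finite sets is linearly independent if there are operators which insert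
an index or, if it is already present, annihilate, and if the top vector is torsion free. -/
theorem linearIndependent_of_insert_operators {R M ι : Type*} [CommRing R] [AddCommGroup M]
    [Module R M] [Fintype ι] [DecidableEq ι] (θ : ι → M →ₗ[R] M) (g : Finset ι → M)
    (hmem : ∀ i s, i ∈ s → θ i (g s) = 0) (hnot : ∀ i s, i ∉ s → θ i (g s) = g (insert i s))
    (htop : ∀ r : R, r • g Finset.univ = 0 → r = 0) : LinearIndependent R g := by
  have key : ∀ J : Finset ι, ∃ Θ : M →ₗ[R] M,
      ∀ s, Θ (g s) = if Disjoint s J then g (s ∪ J) else 0 := fun J => by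
    induction J using Finset.induction_on with
    | empty => exact ⟨LinearMap.id, fun s => by simp⟩
    | insert i J hi ih =>
      obtain ⟨Θ, hΘ⟩ := ih
      refine ⟨θ i ∘ₗ Θ, fun s => ?_⟩
      rw [LinearMap.comp_apply, hΘ]
      simp only [Finset.disjoint_insert_right]
      by_cases hd : Disjoint s J
      · by_cases his : i ∈ s
        · simp [hd, his, hmem i (s ∪ J) (Finset.mem_union_left _ his)]
        · have : i ∉ s ∪ J := by simp [his, hi]
          simp [hd, his, hnot i _ this]
      · simp [hd]
  rw [Fintype.linearIndependent_iff]
  intro c hc s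
  induction s using Finset.strongInduction with
  | H s ih =>
    -- Inserting the complement of `s` kills every term not contained in `s`; smaller terms vanish
    -- by induction, so only `c s • g univ` is left.
    obtain ⟨Θ, hΘ⟩ := key sᶜ
    have h := congrArg Θ hc
    rw [map_sum, map_zero, Finset.sum_eq_single s] at h
    · rw [map_smul, hΘ, if_pos disjoint_compl_right, Finset.union_compl] at h
      exact htop _ h
    · intro t _ hts
      rw [map_smul, hΘ]
      by_cases hd : Disjoint t sᶜ
      · have hsub : t ⊆ s := disjoint_compl_right_iff.mp hd
        rw [ih t (lt_of_le_of_ne hsub hts), zero_smul]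
      · rw [if_neg hd, smul_zero]
    · simp

/-! ### Squares of symmetric elements and self-centralizing subalgebras -/

section SelfCentralizing

variable {F A S ι : Type*} [Field F] [Ring A] [Algebra F A] [CommRing S] [Algebra F S]
  [DecidableEq ι]

/-- The iterated commutator of `a` with the elements `u i`, `i ∈ J` (in characteristic two). -/
def iteratedCommutator (j : S →ₐ[F] A) (u : ι → S) (J : Finset ι) (a : A) : A :=
  ∑ s ∈ J.powerset, j (∏ i ∈ s, u i) * a * j (∏ i ∈ J \ s, u i)

variable (j : S →ₐ[F] A) (u : ι → S)

/-- Split the subsets of `insert i J` according to whether they contain `i`. -/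
theorem commutator_iteratedCommutator {J : Finset ι} {i : ι} (hi : i ∉ J) (a : A) :
    j (u i) * iteratedCommutator j u J a + iteratedCommutator j u J a * j (u i) =
      iteratedCommutator j u (insert i J) a := by
  rw [iteratedCommutator, iteratedCommutator, Finset.sum_powerset_insert hi, Finset.mul_sum,
    Finset.sum_mul, add_comm]
  congr 1 <;> refine Finset.sum_congr rfl fun s hs => ?_
  · have his : i ∉ s := fun h => hi (Finset.mem_powerset.mp hs h)
    rw [Finset.insert_sdiff_of_notMem _ his,
      Finset.prod_insert (fun h => hi (Finset.sdiff_subset h)), mul_comm (u i), map_mul, ← mul_assoc]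
  · have his : i ∉ s := fun h => hi (Finset.mem_powerset.mp hs h)
    have hJ : insert i J \ insert i s = J \ s := by
      ext k
      simp only [Finset.mem_sdiff, Finset.mem_insert, not_or]
      constructor
      · rintro ⟨rfl | h, h1, h2⟩
        · exact absurd rfl h1
        · exact ⟨h, h2⟩
      · rintro ⟨h1, h2⟩
        exact ⟨Or.inr h1, fun h => hi (h ▸ h1), h2⟩
    rw [Finset.prod_insert his, hJ, map_mul, mul_assoc (j (u i)), mul_assoc (j (u i))]

variable [CharP F 2]

/-- In characteristic two `(ad x)^2 = ad(x^2)`, and `x^2` is central. -/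
theorem commutator_commutator (hsq : ∀ x : S, ∃ c : F, x ^ 2 = algebraMap F S c) (x : S) (a : A) :
    j x * (j x * a + a * j x) + (j x * a + a * j x) * j x = 0 := by
  obtain ⟨c, hc⟩ := hsq x
  have h : j x * j x = algebraMap F A c := by rw [← map_mul, ← sq, hc, AlgHom.commutes]
  have h1 : j x * (j x * a + a * j x) + (j x * a + a * j x) * j x =
      (j x * j x) * a + a * (j x * j x) + (j x * a * j x + j x * a * j x) := by noncomm_ring
  rw [h1, h, Algebra.commutes, module_add_self_of_charTwo F, module_add_self_of_charTwo F, add_zero]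

theorem commutator_iteratedCommutator_of_mem (hsq : ∀ x : S, ∃ c : F, x ^ 2 = algebraMap F S c)
    {J : Finset ι} {i : ι} (hi : i ∈ J) (a : A) :
    j (u i) * iteratedCommutator j u J a + iteratedCommutator j u J a * j (u i) = 0 := by
  rw [← Finset.insert_erase hi, ← commutator_iteratedCommutator j u (Finset.notMem_erase i J),
    commutator_commutator j hsq]

variable [Fintype ι] {j u}

/-- A further commutator with any generator vanishes, so the full iterated commutator centralizes
`S`. -/
theorem exists_apply_eq_iteratedCommutator_univ (hu : Algebra.adjoin F (Set.range u) = ⊤)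
    (hsq : ∀ x : S, ∃ c : F, x ^ 2 = algebraMap F S c)
    (hcent : ∀ a, (∀ x, j x * a = a * j x) → ∃ x, j x = a) (a : A) :
    ∃ x, j x = iteratedCommutator j u Finset.univ a := by
  refine hcent _ fun x => ?_
  have hx : x ∈ Algebra.adjoin F (Set.range u) := hu ▸ Algebra.mem_top
  induction hx using Algebra.adjoin_induction with
  | mem x hx =>
    obtain ⟨i, rfl⟩ := hx
    exact (module_add_eq_zero_iff_of_charTwo F).mp
      (commutator_iteratedCommutator_of_mem j u hsq (Finset.mem_univ i) a)
  | algebraMap r => rw [AlgHom.commutes, Algebra.commutes]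
  | add x y _ _ hx hy => rw [map_add, add_mul, mul_add, hx, hy]
  | mul x y _ _ hx hy => rw [map_mul, mul_assoc, hy, ← mul_assoc, hx, mul_assoc]

/-- The square-zero elements of a finite-dimensional algebra with all squares in the field have a
common annihilator. -/
theorem exists_ne_zero_forall_mul_eq_zero [Module.Finite F S] [Nontrivial S] :
    ∃ z : S, z ≠ 0 ∧ ∀ x : S, x ^ 2 = 0 → z * x = 0 := by
  let N : Submodule F S :=
    { carrier := {x | x ^ 2 = 0}
      zero_mem' := by simp
      add_mem' := fun {x y} (hx : x ^ 2 = 0) (hy : y ^ 2 = 0) => by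
        change (x + y) ^ 2 = 0
        linear_combination hx + hy + module_add_self_of_charTwo F (x * y)
      smul_mem' := fun c x (hx : x ^ 2 = 0) => by
        change (c • x) ^ 2 = 0
        rw [smul_pow, hx, smul_zero] }
  have hN : ∀ x : N, (x : S) ^ 2 = 0 := fun x => x.2
  obtain ⟨s, hs⟩ := Module.Finite.fg_top (R := F) (M := N)
  obtain ⟨z, -, hz0, hz⟩ := exists_ne_zero_forall_apply_eq_zero
    (fun x : N => LinearMap.mulLeft F (x : S))
    (fun x y t => by simp only [LinearMap.mulLeft_apply]; ring)
    (fun x t => by simp only [LinearMap.mulLeft_apply]; linear_combination t * hN x)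
    ⊤ (fun _ _ _ => Submodule.mem_top) ⟨1, Submodule.mem_top, one_ne_zero⟩ s
  refine ⟨z, hz0, fun x hx => ?_⟩
  have hxs : (⟨x, hx⟩ : N) ∈ Submodule.span F (s : Set N) := hs ▸ Submodule.mem_top
  have : ∀ y ∈ Submodule.span F (s : Set N), z * (y : S) = 0 := fun y hy => by
    induction hy using Submodule.span_induction with
    | mem y hy => rw [mul_comm]; exact hz y hy
    | zero => simp
    | add a b _ _ ha hb => rw [Submodule.coe_add, mul_add, ha, hb, add_zero]
    | smul c a _ ha => rw [Submodule.coe_smul, mul_smul_comm, ha, smul_zero]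
  exact this _ hxs

/-- Otherwise all full commutators square to zero and share a nonzero annihilator `z` in `S`. Then
`∑ z u^s a u^(sᶜ) = 0` for all `a`; as the monomials are independent, `hinj` at `s = ∅` gives `z =
0`. -/
theorem exists_iteratedCommutator_univ_unit (hj : Function.Injective j)
    (hu : Algebra.adjoin F (Set.range u) = ⊤)
    (hsq : ∀ x : S, ∃ c : F, x ^ 2 = algebraMap F S c)
    (hrank : Module.finrank F S = 2 ^ Fintype.card ι)
    (hcent : ∀ a, (∀ x, j x * a = a * j x) → ∃ x, j x = a)
    (hinj : ∀ x y : Finset ι → A, LinearIndependent F y → (∀ a, ∑ s, x s * a * y s = 0) → x = 0) :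
    ∃ (a : A) (x : S) (c : F), j x = iteratedCommutator j u Finset.univ a ∧
      x ^ 2 = algebraMap F S c ∧ c ≠ 0 := by
  have : Module.Finite F S := Module.finite_of_finrank_pos (by rw [hrank]; positivity)
  have : Nontrivial S := Module.nontrivial_of_finrank_pos (R := F) (by rw [hrank]; positivity)
  by_contra! hcon
  obtain ⟨z, hz0, hz⟩ := exists_ne_zero_forall_mul_eq_zero (F := F) (S := S)
  have hy : LinearIndependent F fun s : Finset ι => j (∏ i ∈ Finset.univ \ s, u i) := by
    have h1 := (linearIndependent_prod hu (fun i => hsq (u i)) hrank).map' j.toLinearMap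
      (LinearMap.ker_eq_bot.mpr hj)
    have h2 := h1.comp (fun s : Finset ι => Finset.univ \ s) fun s t hst => by
      simpa [← Finset.compl_eq_univ_sdiff] using hst
    exact h2
  have h0 := hinj (fun s => j z * j (∏ i ∈ s, u i)) _ hy fun a => by
    obtain ⟨x, hx⟩ := exists_apply_eq_iteratedCommutator_univ hu hsq hcent a
    obtain ⟨c, hc⟩ := hsq x
    have hc0 := hcon a x c hx hc
    rw [hc0, map_zero] at hc
    have h1 : j z * iteratedCommutator j u Finset.univ a = 0 := by
      rw [← hx, ← map_mul, hz x hc, map_zero]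
    rw [iteratedCommutator, Finset.mul_sum, Finset.powerset_univ] at h1
    simpa only [mul_assoc] using h1
  have h1 := congrFun h0 ∅
  simp only [Finset.prod_empty, map_one, mul_one, Pi.zero_apply] at h1
  exact hz0 (hj (h1.trans (map_zero j).symm))

/-- Commutators with the `u i` are `S`-linear insertion operators and the top vector `x₀` is
invertible, so the `2^n` iterated commutators are independent over `S`; dimensions over `F` then
match. -/
theorem exists_sum_eq_of_iteratedCommutator_univ_unit (hj : Function.Injective j)
    (hsq : ∀ x : S, ∃ c : F, x ^ 2 = algebraMap F S c)
    (hrank : Module.finrank F S = 2 ^ Fintype.card ι)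
    (hrankA : Module.finrank F A = (2 ^ Fintype.card ι) ^ 2)
    {a₀ : A} {x₀ : S} {c₀ : F} (hx₀ : j x₀ = iteratedCommutator j u Finset.univ a₀)
    (hc₀ : x₀ ^ 2 = algebraMap F S c₀) (hne : c₀ ≠ 0) (b : A) :
    ∃ x : Finset ι → S, b = ∑ s, j (x s) * iteratedCommutator j u s a₀ := by
  have : Module.Finite F S := Module.finite_of_finrank_pos (by rw [hrank]; positivity)
  have : Module.Finite F A := Module.finite_of_finrank_pos (by rw [hrankA]; positivity)
  let _ : Module S A := Module.compHom A (j : S →+* A)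
  have hsmul : ∀ (x : S) (a : A), x • a = j x * a := fun _ _ => rfl
  have hli : LinearIndependent S fun s : Finset ι => iteratedCommutator j u s a₀ := by
    refine linearIndependent_of_insert_operators (fun i =>
      { toFun := fun a => j (u i) * a + a * j (u i)
        map_add' := fun a b => by noncomm_ring
        map_smul' := fun x a => by
          rw [RingHom.id_apply, hsmul, hsmul, mul_add, ← mul_assoc, ← map_mul, mul_comm, map_mul]
          simp only [mul_assoc] }) _
      (fun i s hi => commutator_iteratedCommutator_of_mem j u hsq hi a₀)
      (fun i s hi => commutator_iteratedCommutator j u hi a₀) fun r hr => ?_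
    rw [hsmul, ← hx₀, ← map_mul, map_eq_zero_iff j hj] at hr
    have h : c₀ • r = 0 := by
      rw [Algebra.smul_def, ← hc₀]
      linear_combination x₀ * hr
    exact (smul_eq_zero_iff_right hne).mp h
  let f : (Finset ι → S) →ₗ[F] A :=
    ∑ s, LinearMap.mulRight F (iteratedCommutator j u s a₀) ∘ₗ j.toLinearMap ∘ₗ LinearMap.proj s
  have hf : ∀ x, f x = ∑ s, j (x s) * iteratedCommutator j u s a₀ := fun x => by
    simp [f, LinearMap.sum_apply]
  have hinj : Function.Injective f := by
    rw [← LinearMap.ker_eq_bot, LinearMap.ker_eq_bot']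
    intro x hx
    rw [hf] at hx
    exact funext fun s => Fintype.linearIndependent_iff.mp hli x hx s
  have hfr : Module.finrank F (Finset ι → S) = Module.finrank F A := by
    rw [Module.finrank_pi_fintype, hrankA]
    simp [hrank, sq]
  obtain ⟨x, hx⟩ :=
    (LinearMap.injective_iff_surjective_of_finrank_eq_finrank hfr).mp hinj b
  exact ⟨x, by rw [← hx, hf]⟩

/-- Let `S` be a self-centralizing algebra of symmetric elements as in `IsPhi`. If `1` is not of
the form `x + σ(x)`, then every square in `F` of a symmetric element is the square of an element
of `S`. -/
theorem exists_sq_eq_of_symmetric (σ : AlgInvolution F A) (hone : ∀ x, x + σ.toLin x ≠ 1)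
    (hj : Function.Injective j) (hσ : ∀ x, σ.toLin (j x) = j x)
    (hu : Algebra.adjoin F (Set.range u) = ⊤)
    (hsq : ∀ x : S, ∃ c : F, x ^ 2 = algebraMap F S c)
    (hrank : Module.finrank F S = 2 ^ Fintype.card ι)
    (hrankA : Module.finrank F A = (2 ^ Fintype.card ι) ^ 2)
    (hcent : ∀ a, (∀ x, j x * a = a * j x) → ∃ x, j x = a)
    (hinj : ∀ x y : Finset ι → A, LinearIndependent F y → (∀ a, ∑ s, x s * a * y s = 0) → x = 0)
    {t : A} (ht : σ.toLin t = t) {c : F} (hc : t ^ 2 = algebraMap F A c) :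
    ∃ x : S, x ^ 2 = algebraMap F S c := by
  obtain ⟨a₀, x₀, c₀, hx₀, hc₀, hne⟩ :=
    exists_iteratedCommutator_univ_unit hj hu hsq hrank hcent hinj
  have hsum := exists_sum_eq_of_iteratedCommutator_univ_unit hj hsq hrank hrankA hx₀ hc₀ hne
  let Alt : Submodule F A := LinearMap.range (LinearMap.id + σ.toLin)
  have hAlt : ∀ y, y + σ.toLin y ∈ Alt := fun y => ⟨y, rfl⟩
  have hAlt_one : ∀ r : F, r • (Submodule.Quotient.mk 1 : A ⧸ Alt) = 0 → r = 0 := fun r hr => by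
    by_contra hr0
    rw [smul_eq_zero_iff_right hr0, Submodule.Quotient.mk_eq_zero] at hr
    obtain ⟨y, hy⟩ := hr
    exact hone y hy
  have hanti := σ.anti_mul
  have hinv := σ.involutive
  -- Additive because the cross terms `σ(b)b' + σ(b')b` lie in `Alt`.
  let Q : A →+ A ⧸ Alt :=
    { toFun := fun b => Submodule.Quotient.mk (σ.toLin b * b)
      map_zero' := by simp
      map_add' := fun b b' => by
        rw [← Submodule.Quotient.mk_add, Submodule.Quotient.eq]
        convert hAlt (σ.toLin b * b') using 1
        rw [hanti, hinv, map_add]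
        noncomm_ring }
  have hQ : ∀ b, Q b = Submodule.Quotient.mk (σ.toLin b * b) := fun _ => rfl
  have hjsq : ∀ (x : S) (k : F), x ^ 2 = algebraMap F S k → j x * j x = algebraMap F A k :=
    fun x k h => by rw [← map_mul, ← sq, h, AlgHom.commutes]
  have hQmul : ∀ (x : S) (k : F) (b : A), x ^ 2 = algebraMap F S k → Q (j x * b) = k • Q b :=
    fun x k b h => by
      rw [hQ, hQ, ← Submodule.Quotient.mk_smul, hanti, hσ, mul_assoc, ← mul_assoc (j x) (j x),
        hjsq x k h, ← Algebra.smul_def, mul_smul_comm]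
  choose k hk using hsq
  have hQone : Q 1 = Submodule.Quotient.mk 1 := by
    rw [hQ, mul_one, ← map_one j, hσ]
  have hli : LinearIndependent F fun s : Finset ι => Q (iteratedCommutator j u s a₀) := by
    -- On the quotient, `y ↦ u y u + u^2 y` sends `Q a` to `Q (u a + a u)`, so it serves as
    -- insertion operator; the top vector is `c₀ • 1`, nonzero because `1` is not in `Alt`.
    let ψ : ι → A →ₗ[F] A := fun i =>
      LinearMap.mulLeft F (j (u i)) ∘ₗ LinearMap.mulRight F (j (u i)) +
        LinearMap.lsmul F A (k (u i))
    have hψ : ∀ i y, ψ i y = j (u i) * (y * j (u i)) + k (u i) • y := fun _ _ => rfl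
    have hψAlt : ∀ i, Alt ≤ Alt.comap (ψ i) := by
      rintro i _ ⟨y, rfl⟩
      refine ⟨ψ i y, ?_⟩
      simp only [LinearMap.add_apply, LinearMap.id_apply, hψ, map_add, hanti, hσ, map_smul,
        smul_add]
      noncomm_ring
    have hψQ : ∀ i a, Alt.mapQ Alt (ψ i) (hψAlt i) (Q a) =
        Q (j (u i) * a + a * j (u i)) := fun i a => by
      rw [hQ, hQ, Submodule.mapQ_apply, Submodule.Quotient.eq, hψ]
      have hsmul : k (u i) • (σ.toLin a * a) = σ.toLin a * (j (u i) * j (u i)) * a := by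
        rw [hjsq _ _ (hk (u i)), ← Algebra.commutes, Algebra.smul_def, mul_assoc]
      convert neg_mem (hAlt (j (u i) * σ.toLin a * j (u i) * a)) using 1
      simp only [hsmul, map_add, hanti, hσ, hinv]
      noncomm_ring
    refine linearIndependent_of_insert_operators
      (fun i => Alt.mapQ Alt (ψ i) (hψAlt i)) _ (fun i s hi => ?_) (fun i s hi => ?_) fun r hr => ?_
    · rw [hψQ, commutator_iteratedCommutator_of_mem j u (fun x => ⟨k x, hk x⟩) hi, map_zero]
    · rw [hψQ, commutator_iteratedCommutator j u hi]
    · rw [← hx₀, ← mul_one (j x₀), hQmul x₀ c₀ 1 hc₀, hQone, smul_smul] at hr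
      exact (mul_eq_zero.mp (hAlt_one _ hr)).resolve_right hne
  have hQsum : ∀ x : Finset ι → S, Q (∑ s, j (x s) * iteratedCommutator j u s a₀) =
      ∑ s, k (x s) • Q (iteratedCommutator j u s a₀) := fun x => by
    rw [map_sum]
    exact Finset.sum_congr rfl fun s _ => hQmul _ _ _ (hk (x s))
  obtain ⟨x, hx⟩ := hsum 1
  obtain ⟨y, hy⟩ := hsum t
  have hQ1 := hQsum x
  have hQt := hQsum y
  rw [← hx] at hQ1
  have hQt' : Q t = c • Q 1 := by
    rw [hQone, hQ, ht, ← sq, hc, ← Submodule.Quotient.mk_smul, Algebra.algebraMap_eq_smul_one]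
  rw [← hy, hQt', hQ1, Finset.smul_sum, ← sub_eq_zero, ← Finset.sum_sub_distrib] at hQt
  simp only [smul_smul, ← sub_smul] at hQt
  have hcoef : ∀ s, c * k (x s) = k (y s) := fun s =>
    sub_eq_zero.mp (Fintype.linearIndependent_iff.mp hli _ hQt s)
  -- If every `x s` had square zero, `Q 1` would vanish, putting `1` in `Alt`.
  obtain ⟨s, hs⟩ : ∃ s, k (x s) ≠ 0 := by
    by_contra! h0
    simp only [h0, zero_smul, Finset.sum_const_zero] at hQ1
    exact one_ne_zero (hAlt_one 1 (by rw [one_smul, ← hQone, hQ1]))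
  -- This is `y_s / x_s`, since `x_s⁻¹ = x_s / x_s^2`.
  refine ⟨(k (x s))⁻¹ • (y s * x s), ?_⟩
  rw [smul_pow, mul_pow, hk, hk, ← hcoef, ← map_mul, Algebra.smul_def, ← map_mul]
  congr 1
  field_simp

end SelfCentralizing

/-! ### Classification of algebras with squares in the field -/

section SquaresInField

variable {F S T : Type*} [Field F] [CommRing S] [Algebra F S] [CommRing T] [Algebra F T]

theorem exists_add_mul_of_mem_adjoin_insert {E : Subalgebra F S} {x : S} {c : F}
    (hx : x ^ 2 = algebraMap F S c) {y : S} (hy : y ∈ Algebra.adjoin F {x} ⊔ E) :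
    ∃ a ∈ E, ∃ b ∈ E, y = a + x * b := by
  rw [← Algebra.adjoin_eq E, ← Algebra.adjoin_union] at hy
  induction hy using Algebra.adjoin_induction with
  | mem y hy =>
    rcases hy with rfl | hy
    · exact ⟨0, zero_mem _, 1, one_mem _, by ring⟩
    · exact ⟨y, hy, 0, zero_mem _, by ring⟩
  | algebraMap r => exact ⟨_, E.algebraMap_mem r, 0, zero_mem _, by ring⟩
  | add y z _ _ hy hz =>
    obtain ⟨a, ha, b, hb, rfl⟩ := hy
    obtain ⟨a', ha', b', hb', rfl⟩ := hz
    exact ⟨a + a', add_mem ha ha', b + b', add_mem hb hb', by ring⟩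
  | mul y z _ _ hy hz =>
    obtain ⟨a, ha, b, hb, rfl⟩ := hy
    obtain ⟨a', ha', b', hb', rfl⟩ := hz
    refine ⟨a * a' + algebraMap F S c * (b * b'),
      add_mem (mul_mem ha ha') (mul_mem (E.algebraMap_mem c) (mul_mem hb hb')),
      a * b' + b * a', add_mem (mul_mem ha hb') (mul_mem hb ha'), ?_⟩
    rw [← hx]
    ring

/-- Generators with squares in `F` can be normalized: some of them generate a reduced algebra, and
the others have square zero. -/
theorem exists_normalized_generators [Nontrivial S] (hsq : ∀ x : S, ∃ c, x ^ 2 = algebraMap F S c)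
    {n : ℕ} (u : Fin n → S) :
    ∃ (k m : ℕ) (s : Fin k → S) (ε : Fin m → S), k + m = n ∧
      (∀ x ∈ Algebra.adjoin F (Set.range s), x ^ 2 = 0 → x = 0) ∧ (∀ i, ε i ^ 2 = 0) ∧
      Algebra.adjoin F (Set.range s) ⊔ Algebra.adjoin F (Set.range ε) =
        Algebra.adjoin F (Set.range u) := by
  induction n with
  | zero =>
    refine ⟨0, 0, u, u, rfl, fun x hx h0 => ?_, fun i => i.elim0, sup_idem _⟩
    rw [Set.range_eq_empty, Algebra.adjoin_empty, Algebra.mem_bot] at hx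
    obtain ⟨c, rfl⟩ := hx
    rw [← map_pow, map_eq_zero_iff _ (algebraMap F S).injective] at h0
    rw [pow_eq_zero_iff two_ne_zero |>.mp h0, map_zero]
  | succ n ih =>
    obtain ⟨k, m, s, ε, hkm, hred, hε, hgen⟩ := ih (Fin.tail u)
    set x := u 0 with hx
    have hrange : Algebra.adjoin F (Set.range u) =
        Algebra.adjoin F {x} ⊔ Algebra.adjoin F (Set.range (Fin.tail u)) := by
      conv_lhs => rw [← Fin.cons_self_tail u, Fin.range_cons, Set.insert_eq, Algebra.adjoin_union]
    set E := Algebra.adjoin F (Set.range s) with hE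
    by_cases hex : ∃ e ∈ E, (x + e) ^ 2 = 0
    · obtain ⟨e, he, hxe⟩ := hex
      refine ⟨k, m + 1, s, Fin.cons (x + e) ε, by omega, hred, fun i => ?_, ?_⟩
      · refine Fin.cases ?_ (fun i => ?_) i
        · simpa using hxe
        · simpa using hε i
      · rw [hrange, ← hgen, Fin.range_cons, Set.insert_eq, Algebra.adjoin_union,
          sup_left_comm]
        have heE : e ∈ E ⊔ Algebra.adjoin F (Set.range ε) := (le_sup_left : E ≤ _) he
        apply le_antisymm <;> refine sup_le ?_ le_sup_right <;>
          rw [Algebra.adjoin_le_iff, Set.singleton_subset_iff]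
        · exact add_mem ((le_sup_left : Algebra.adjoin F {x} ≤ _)
            (Algebra.self_mem_adjoin_singleton F x)) ((le_sup_right : _ ≤ Algebra.adjoin F {x} ⊔ _) heE)
        · have h1 := sub_mem ((le_sup_left : Algebra.adjoin F {x + e} ≤ _ ⊔
            (E ⊔ Algebra.adjoin F (Set.range ε))) (Algebra.self_mem_adjoin_singleton F (x + e)))
            ((le_sup_right : _ ≤ Algebra.adjoin F {x + e} ⊔ _) heE)
          rwa [add_sub_cancel_right] at h1
    · push Not at hex
      refine ⟨k + 1, m, Fin.cons x s, ε, by omega, fun y hy h0 => ?_, hε, ?_⟩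
      · rw [Fin.range_cons, Set.insert_eq, Algebra.adjoin_union] at hy
        obtain ⟨c, hc⟩ := hsq x
        obtain ⟨a, ha, b, hb, rfl⟩ := exists_add_mul_of_mem_adjoin_insert hc hy
        obtain ⟨d, hd⟩ := hsq b
        by_cases hd0 : d = 0
        · have hb0 : b = 0 := hred b hb (by rw [hd, hd0, map_zero])
          rw [hb0, mul_zero, add_zero] at h0 ⊢
          exact hred a ha h0
        -- Multiplying `(a + xb)^2 = 0` by `(b/d)^2`, where `b^2 = d`, turns it into `(x + ab/d)^2 =
        -- 0`.
        · refine absurd ?_ (hex (d⁻¹ • (a * b)) (E.smul_mem (mul_mem ha hb) _))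
          have hdd : algebraMap F S d⁻¹ * b ^ 2 = 1 := by
            rw [hd, ← map_mul, inv_mul_cancel₀ hd0, map_one]
          rw [Algebra.smul_def]
          linear_combination (algebraMap F S d⁻¹) ^ 2 * b ^ 2 * h0 -
            x * (x * (algebraMap F S d⁻¹ * b ^ 2 + 1) + 2 * a * b * algebraMap F S d⁻¹) * hdd
      · rw [hrange, ← hgen, Fin.range_cons, Set.insert_eq, Algebra.adjoin_union, sup_assoc]

variable [CharP F 2]

theorem smul_sum_sq_of_charTwo {κ : Type*} [Fintype κ] {s : κ → S} {α : κ → F}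
    (hs : ∀ i, s i ^ 2 = algebraMap F S (α i)) (c : κ → F) :
    (∑ i, c i • s i) ^ 2 = algebraMap F S (∑ i, c i ^ 2 * α i) := by
  classical
  have key : ∀ J : Finset κ, (∑ i ∈ J, c i • s i) ^ 2 =
      algebraMap F S (∑ i ∈ J, c i ^ 2 * α i) := fun J => by
    induction J using Finset.induction_on with
    | empty => simp
    | insert i J hi ih =>
      rw [Finset.sum_insert hi, Finset.sum_insert hi, map_add, ← ih, map_mul, ← hs, map_pow,
        Algebra.smul_def]
      linear_combination module_add_self_of_charTwo F (algebraMap F S (c i) * s i * ∑ i ∈ J, c i • s i)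
  exact key Finset.univ

/-- An algebra of dimension `2 ^ n` generated by `n` elements with squares in `F` is a Clifford
algebra. -/
theorem exists_cliffordAlgebra_equiv {κ : Type*} [Fintype κ] [DecidableEq κ] {s : κ → S}
    {α : κ → F} (hs : ∀ i, s i ^ 2 = algebraMap F S (α i))
    (hgen : Algebra.adjoin F (Set.range s) = ⊤)
    (hrank : Module.finrank F S = 2 ^ Fintype.card κ) :
    ∃ Φ : CliffordAlgebra (QuadraticMap.weightedSumSquares F α) ≃ₐ[F] S,
      ∀ i, Φ (CliffordAlgebra.ι _ (Pi.single i 1)) = s i := by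
  have : Module.Finite F S := Module.finite_of_finrank_pos (by rw [hrank]; positivity)
  have := CliffordAlgebra.finite_of_finiteDimensional (QuadraticMap.weightedSumSquares F α)
  let f : (κ → F) →ₗ[F] S := Fintype.linearCombination F s
  have hf : ∀ x, f x * f x = algebraMap F S (QuadraticMap.weightedSumSquares F α x) := fun x => by
    rw [← sq, Fintype.linearCombination_apply, smul_sum_sq_of_charTwo hs,
      QuadraticMap.weightedSumSquares_apply]
    congr 1
    exact Finset.sum_congr rfl fun i _ => by rw [smul_eq_mul]; ring
  let φ := CliffordAlgebra.lift (QuadraticMap.weightedSumSquares F α) ⟨f, hf⟩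
  have hφ : ∀ i, φ (CliffordAlgebra.ι _ (Pi.single i 1)) = s i := fun i => by
    rw [CliffordAlgebra.lift_ι_apply, Fintype.linearCombination_apply_single, one_smul]
  have hsurj : Function.Surjective φ := by
    rw [← AlgHom.range_eq_top, eq_top_iff, ← hgen, Algebra.adjoin_le_iff]
    rintro _ ⟨i, rfl⟩
    exact ⟨_, hφ i⟩
  have hinj : Function.Injective φ :=
    (LinearMap.injective_iff_surjective_of_finrank_eq_finrank (f := φ.toLinearMap)
      (by rw [CliffordAlgebra.finrank_of_charTwo, hrank, Module.finrank_fintype_fun_eq_card])).mpr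
      hsurj
  exact ⟨AlgEquiv.ofBijective φ ⟨hinj, hsurj⟩, hφ⟩

theorem finrank_subalgebra_map_algEquiv {F A B : Type*} [Field F] [Ring A] [Algebra F A] [Ring B]
    [Algebra F B] (Φ : A ≃ₐ[F] B) (C : Subalgebra F A) :
    Module.finrank F (C.map (Φ : A →ₐ[F] B)) = Module.finrank F C :=
  (C.equivMapOfInjective (Φ : A →ₐ[F] B) Φ.injective).toLinearEquiv.finrank_eq.symm

/-- In the Clifford model the `s i` are the coordinate vectors, so a subfamily generates the algebra
of a coordinate subspace. -/
theorem finrank_adjoin_range_comp {κ κ' : Type*} [Fintype κ] [Fintype κ'] {s : κ → S}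
    (hs : ∀ i, ∃ c, s i ^ 2 = algebraMap F S c)
    (hgen : Algebra.adjoin F (Set.range s) = ⊤)
    (hrank : Module.finrank F S = 2 ^ Fintype.card κ) {f : κ' → κ} (hf : Function.Injective f) :
    Module.finrank F (Algebra.adjoin F (Set.range (s ∘ f))) = 2 ^ Fintype.card κ' := by
  classical
  choose α hα using hs
  obtain ⟨Φ, hΦ⟩ := exists_cliffordAlgebra_equiv hα hgen hrank
  let e : κ' → κ → F := fun i => Pi.single (f i) 1
  have he : LinearIndependent F e := by
    have := (Pi.basisFun F κ).linearIndependent.comp f hf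
    convert this using 1
    ext i
    simp [e]
  have h1 := CliffordAlgebra.finrank_adjoinSubmodule (q := QuadraticMap.weightedSumSquares F α)
    (Submodule.span F (Set.range e))
  rw [finrank_span_eq_card he, CliffordAlgebra.adjoinSubmodule_span, ← Set.range_comp] at h1
  rw [← h1]
  have h2 : (Algebra.adjoin F (Set.range (CliffordAlgebra.ι (QuadraticMap.weightedSumSquares F α) ∘
      e))).map (Φ : _ →ₐ[F] S) = Algebra.adjoin F (Set.range (s ∘ f)) := by
    rw [AlgHom.map_adjoin, ← Set.range_comp]
    congr 2
    ext i
    exact hΦ (f i)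
  rw [← h2, finrank_subalgebra_map_algEquiv]

/-- Comparison of dimensions through squares. -/
theorem finrank_le_of_forall_exists_sq [Nontrivial T] (hsq : ∀ x : S, ∃ c, x ^ 2 = algebraMap F S c)
    {A : Subalgebra F S} {B : Subalgebra F T} [Module.Finite F A] [Module.Finite F B]
    (hA : ∀ x ∈ A, x ^ 2 = 0 → x = 0)
    (h : ∀ x ∈ A, ∀ c, x ^ 2 = algebraMap F S c → ∃ y ∈ B, y ^ 2 = algebraMap F T c) :
    Module.finrank F A ≤ Module.finrank F B := by
  let b := Module.finBasis F A
  choose α hα using fun i => hsq (b i)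
  choose y hyB hy using fun i => h (b i) (b i).2 (α i) (hα i)
  -- Squaring is additive, so a relation among the `y i` squares to one on the `α i`; the same
  -- combination of the `b i` then has square zero, hence vanishes in the reduced algebra `A`.
  have hli : LinearIndependent F fun i => (⟨y i, hyB i⟩ : B) := by
    rw [Fintype.linearIndependent_iff]
    intro c hc
    have hc' : ∑ i, c i • y i = 0 := by simpa using congrArg B.val hc
    have h1 := smul_sum_sq_of_charTwo hy c
    rw [hc', zero_pow two_ne_zero, eq_comm, map_eq_zero_iff _ (algebraMap F T).injective] at h1
    have h2 := smul_sum_sq_of_charTwo hα c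
    rw [h1, map_zero] at h2
    have h3 : (∑ i, c i • (b i : S)) ∈ A := sum_mem fun i _ => A.smul_mem (b i).2 _
    have h4 := hA _ h3 h2
    have h5 : ∑ i, c i • b i = 0 := Subtype.ext (by simpa using h4)
    exact Fintype.linearIndependent_iff.mp b.linearIndependent c h5
  simpa using hli.fintype_card_le_finrank

/-- Square-zero generators add no new squares: modulo elements of square zero, everything lies in
`E`. -/
theorem exists_mem_sq_eq_sq {E : Subalgebra F S} {κ : Type*} {ε : κ → S}
    (hε : ∀ i, ε i ^ 2 = 0) (hgen : E ⊔ Algebra.adjoin F (Set.range ε) = ⊤) (x : S) :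
    ∃ e ∈ E, x ^ 2 = e ^ 2 := by
  suffices h : ∃ e ∈ E, (x + e) ^ 2 = 0 by
    obtain ⟨e, he, h⟩ := h
    exact ⟨e, he, by
      linear_combination h - module_add_self_of_charTwo F (e ^ 2) -
        module_add_self_of_charTwo F (x * e)⟩
  have hx : x ∈ E ⊔ Algebra.adjoin F (Set.range ε) := hgen ▸ Algebra.mem_top
  rw [← Algebra.adjoin_eq E, ← Algebra.adjoin_union] at hx
  induction hx using Algebra.adjoin_induction with
  | mem x hx =>
    rcases hx with hx | ⟨i, rfl⟩
    · exact ⟨x, hx, by rw [module_add_self_of_charTwo F, zero_pow two_ne_zero]⟩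
    · exact ⟨0, zero_mem _, by rw [add_zero, hε]⟩
  | algebraMap r =>
    exact ⟨_, E.algebraMap_mem r, by rw [module_add_self_of_charTwo F, zero_pow two_ne_zero]⟩
  | add x y _ _ hx hy =>
    obtain ⟨e, he, hxe⟩ := hx
    obtain ⟨e', he', hye⟩ := hy
    exact ⟨e + e', add_mem he he', by
      linear_combination hxe + hye + module_add_self_of_charTwo F ((x + e) * (y + e'))⟩
  | mul x y _ _ hx hy =>
    obtain ⟨e, he, hxe⟩ := hx
    obtain ⟨e', he', hye⟩ := hy
    refine ⟨e * e', mul_mem he he', ?_⟩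
    have h2 : (2 : S) = 0 := by
      rw [← one_add_one_eq_two, module_add_self_of_charTwo F]
    linear_combination y ^ 2 * hxe + e ^ 2 * hye + (x * e * y * e' - x * e * y ^ 2 - e ^ 2 * y ^ 2 -
      e ^ 2 * y * e') * h2

theorem nonempty_algEquiv_of_sq_eq {κ : Type*} [Fintype κ] {s : κ → S} {t : κ → T} {α : κ → F}
    (hs : ∀ i, s i ^ 2 = algebraMap F S (α i)) (ht : ∀ i, t i ^ 2 = algebraMap F T (α i))
    (hgs : Algebra.adjoin F (Set.range s) = ⊤) (hgt : Algebra.adjoin F (Set.range t) = ⊤)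
    (hrs : Module.finrank F S = 2 ^ Fintype.card κ)
    (hrt : Module.finrank F T = 2 ^ Fintype.card κ) : Nonempty (S ≃ₐ[F] T) := by
  classical
  obtain ⟨Φ, -⟩ := exists_cliffordAlgebra_equiv hs hgs hrs
  obtain ⟨Ψ, -⟩ := exists_cliffordAlgebra_equiv ht hgt hrt
  exact ⟨Φ.symm.trans Ψ⟩

/-- Two algebras of dimension `2 ^ n`, generated by `n` elements, with all squares in `F`, are
isomorphic as soon as they have the same squares. -/
theorem nonempty_algEquiv_of_forall_sq_iff {n : ℕ}
    (hsqS : ∀ x : S, ∃ c, x ^ 2 = algebraMap F S c) (hsqT : ∀ x : T, ∃ c, x ^ 2 = algebraMap F T c)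
    {u : Fin n → S} {v : Fin n → T} (hu : Algebra.adjoin F (Set.range u) = ⊤)
    (hv : Algebra.adjoin F (Set.range v) = ⊤) (hrS : Module.finrank F S = 2 ^ n)
    (hrT : Module.finrank F T = 2 ^ n)
    (h : ∀ c, (∃ x : S, x ^ 2 = algebraMap F S c) ↔ ∃ y : T, y ^ 2 = algebraMap F T c) :
    Nonempty (S ≃ₐ[F] T) := by
  have : Module.Finite F S := Module.finite_of_finrank_pos (by rw [hrS]; positivity)
  have : Module.Finite F T := Module.finite_of_finrank_pos (by rw [hrT]; positivity)
  have : Nontrivial S := Module.nontrivial_of_finrank_pos (R := F) (by rw [hrS]; positivity)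
  have : Nontrivial T := Module.nontrivial_of_finrank_pos (R := F) (by rw [hrT]; positivity)
  obtain ⟨k, m, s, ε, hkm, hred, hε, hgen⟩ := exists_normalized_generators hsqS u
  obtain ⟨k', m', s', ε', hkm', hred', hε', hgen'⟩ := exists_normalized_generators hsqT v
  rw [hu] at hgen
  rw [hv] at hgen'
  have hadj : Algebra.adjoin F (Set.range (Sum.elim s ε)) = ⊤ := by
    rw [Set.Sum.elim_range, Algebra.adjoin_union, hgen]
  have hadj' : Algebra.adjoin F (Set.range (Sum.elim s' ε')) = ⊤ := by
    rw [Set.Sum.elim_range, Algebra.adjoin_union, hgen']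
  have hE := finrank_adjoin_range_comp (fun i => hsqS (Sum.elim s ε i)) hadj
    (by simpa [hkm] using hrS) Sum.inl_injective
  have hE' := finrank_adjoin_range_comp (fun i => hsqT (Sum.elim s' ε' i)) hadj'
    (by simpa [hkm'] using hrT) Sum.inl_injective
  rw [Sum.elim_comp_inl, Fintype.card_fin] at hE hE'
  have hST : ∀ c, (∃ x : S, x ^ 2 = algebraMap F S c) →
      ∃ y ∈ Algebra.adjoin F (Set.range s'), y ^ 2 = algebraMap F T c := fun c hc => by
    obtain ⟨y, hy⟩ := (h c).mp hc
    obtain ⟨e, he, hye⟩ := exists_mem_sq_eq_sq hε' hgen' y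
    exact ⟨e, he, hye ▸ hy⟩
  have hTS : ∀ c, (∃ y : T, y ^ 2 = algebraMap F T c) →
      ∃ x ∈ Algebra.adjoin F (Set.range s), x ^ 2 = algebraMap F S c := fun c hc => by
    obtain ⟨x, hx⟩ := (h c).mpr hc
    obtain ⟨e, he, hxe⟩ := exists_mem_sq_eq_sq hε hgen x
    exact ⟨e, he, hxe ▸ hx⟩
  have hle := finrank_le_of_forall_exists_sq hsqS hred fun x _ c hx => hST c ⟨x, hx⟩
  have hge := finrank_le_of_forall_exists_sq hsqT hred' fun y _ c hy => hTS c ⟨y, hy⟩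
  rw [hE, hE'] at hle hge
  obtain rfl : k = k' := Nat.pow_right_injective le_rfl (le_antisymm hle hge)
  obtain rfl : m = m' := by omega
  choose α hα using fun i => hsqS (s i)
  -- The reduced parts have equal dimension. Choosing `t i` in the second one with the square of `s
  -- i` and comparing dimensions again shows that the `t i` generate it.
  choose t htE ht using fun i => hST (α i) ⟨s i, hα i⟩
  have htle : Algebra.adjoin F (Set.range t) ≤ Algebra.adjoin F (Set.range s') := by
    rw [Algebra.adjoin_le_iff]
    rintro _ ⟨i, rfl⟩
    exact htE i
  have hsqt : ∀ x ∈ Algebra.adjoin F (Set.range s), ∃ y ∈ Algebra.adjoin F (Set.range t), ∃ d,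
      x ^ 2 = algebraMap F S d ∧ y ^ 2 = algebraMap F T d := fun x hx => by
    induction hx using Algebra.adjoin_induction with
    | mem x hx =>
      obtain ⟨i, rfl⟩ := hx
      exact ⟨t i, Algebra.subset_adjoin ⟨i, rfl⟩, α i, hα i, ht i⟩
    | algebraMap r =>
      exact ⟨_, Subalgebra.algebraMap_mem _ r, r ^ 2, by rw [map_pow], by rw [map_pow]⟩
    | add x y _ _ hx hy =>
      obtain ⟨a, ha, d, hd, hd'⟩ := hx
      obtain ⟨b, hb, e, he, he'⟩ := hy
      refine ⟨a + b, add_mem ha hb, d + e, ?_, ?_⟩ <;> rw [map_add]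
      · linear_combination hd + he + module_add_self_of_charTwo F (x * y)
      · linear_combination hd' + he' + module_add_self_of_charTwo F (a * b)
    | mul x y _ _ hx hy =>
      obtain ⟨a, ha, d, hd, hd'⟩ := hx
      obtain ⟨b, hb, e, he, he'⟩ := hy
      exact ⟨a * b, mul_mem ha hb, d * e, by rw [mul_pow, hd, he, map_mul],
        by rw [mul_pow, hd', he', map_mul]⟩
  have hrank := finrank_le_of_forall_exists_sq (B := Algebra.adjoin F (Set.range t)) hsqS hred
    fun x hx c hc => by
      obtain ⟨y, hy, d, hd, hd'⟩ := hsqt x hx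
      rw [hd] at hc
      exact ⟨y, hy, by rw [hd', (algebraMap F S).injective hc]⟩
  rw [hE, ← hE'] at hrank
  have hteq := Subalgebra.eq_of_le_of_finrank_le htle hrank
  refine nonempty_algEquiv_of_sq_eq (s := Sum.elim s ε) (t := Sum.elim t ε') (α := Sum.elim α 0)
    ?_ ?_ hadj ?_ (by simpa [hkm] using hrS) (by simpa [hkm] using hrT)
  · rintro (i | i)
    · exact hα i
    · simpa using hε i
  · rintro (i | i)
    · exact ht i
    · simpa using hε' i
  · rw [Set.Sum.elim_range, Algebra.adjoin_union, hteq, hgen']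

end SquaresInField

/-! ### Uniqueness of the isomorphism class -/

section Uniqueness

variable {F A : Type*} [Field F] [Ring A] [Algebra F A]

theorem IsPhi.mul_comm_of_mem {σ : AlgInvolution F A}
    {S : Subalgebra F A} (hS : IsPhi σ S) {x y : A} (hx : x ∈ S) (hy : y ∈ S) : x * y = y * x := by
  rw [← hS.2.2.1, Subalgebra.mem_centralizer_iff] at hy
  exact hy x hx

theorem adjoin_range_codRestrict_eq_top {κ : Type*} {S : Subalgebra F A}
    {u : κ → A} (hu : Algebra.adjoin F (Set.range u) = S) (hmem : ∀ i, u i ∈ S) :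
    Algebra.adjoin F (Set.range fun i => (⟨u i, hmem i⟩ : S)) = ⊤ := by
  apply Subalgebra.map_injective (f := S.val) Subtype.val_injective
  rw [AlgHom.map_adjoin, ← Set.range_comp, Algebra.map_top, Subalgebra.range_val]
  exact hu

/-- Uniqueness of the algebras described by `IsPhi` when `1` is not of the form `x + σ(x)`. -/
theorem IsPhi.nonempty_algEquiv [CharP F 2] {σ : AlgInvolution F A}
    (hone : ∀ x, x + σ.toLin x ≠ 1)
    (hinj : ∀ {κ : Type} [Fintype κ] (x y : κ → A), LinearIndependent F y →
      (∀ a, ∑ i, x i * a * y i = 0) → x = 0)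
    {S T : Subalgebra F A} (hS : IsPhi σ S) (hT : IsPhi σ T) : Nonempty (S ≃ₐ[F] T) := by
  -- Elements of `T` are symmetric with square in `F`, so this bounds the squares of `T` by those of
  -- `S`, and conversely.
  have key : ∀ {S : Subalgebra F A}, IsPhi σ S → ∀ t : A, σ.toLin t = t → ∀ c : F,
      t ^ 2 = algebraMap F A c → ∃ x : S, x ^ 2 = algebraMap F S c := fun {S} hS t ht c hc => by
    let _ : CommRing S := { (inferInstance : Ring S) with
      mul_comm := fun x y => Subtype.ext (hS.mul_comm_of_mem x.2 y.2) }
    obtain ⟨hσ, hsq, hcent, n, hrA, hrS, u, hu⟩ := hS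
    have hmem : ∀ i, u i ∈ S := fun i => hu ▸ Algebra.subset_adjoin ⟨i, rfl⟩
    exact exists_sq_eq_of_symmetric (j := S.val) (u := fun i => (⟨u i, hmem i⟩ : S)) σ hone
      Subtype.val_injective (fun x => hσ x x.2) (adjoin_range_codRestrict_eq_top hu hmem)
      (fun x => (hsq x x.2).imp fun c hc => Subtype.ext hc)
      (by rwa [Fintype.card_fin]) (by rwa [Fintype.card_fin])
      (fun a ha => ⟨⟨a, by
        rw [← hcent, Subalgebra.mem_centralizer_iff]
        exact fun x hx => ha ⟨x, hx⟩⟩, rfl⟩) (fun x y hy h => hinj x y hy h) ht hc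
  have keyS := key hS
  have keyT := key hT
  have hcommS : ∀ x y : S, x * y = y * x := fun x y => Subtype.ext (hS.mul_comm_of_mem x.2 y.2)
  have hcommT : ∀ x y : T, x * y = y * x := fun x y => Subtype.ext (hT.mul_comm_of_mem x.2 y.2)
  obtain ⟨hσS, hsqS, -, n, hrA, hrS, u, hu⟩ := hS
  obtain ⟨hσT, hsqT, -, n', hrA', hrT, v, hv⟩ := hT
  have hn : n = n' := by
    rw [hrA, ← pow_mul, ← pow_mul] at hrA'
    have := Nat.pow_right_injective le_rfl hrA'
    omega
  subst hn
  have hmemS : ∀ i, u i ∈ S := fun i => hu ▸ Algebra.subset_adjoin ⟨i, rfl⟩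
  have hmemT : ∀ i, v i ∈ T := fun i => hv ▸ Algebra.subset_adjoin ⟨i, rfl⟩
  let _ : CommRing S := { (inferInstance : Ring S) with mul_comm := hcommS }
  let _ : CommRing T := { (inferInstance : Ring T) with mul_comm := hcommT }
  refine nonempty_algEquiv_of_forall_sq_iff (S := S) (T := T)
    (fun x => (hsqS x x.2).imp fun c hc => Subtype.ext hc)
    (fun x => (hsqT x x.2).imp fun c hc => Subtype.ext hc)
    (adjoin_range_codRestrict_eq_top hu hmemS) (adjoin_range_codRestrict_eq_top hv hmemT) hrS hrT
    fun c => ⟨?_, ?_⟩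
  · rintro ⟨x, hx⟩
    exact keyT x (hσS x x.2) c (congrArg Subtype.val hx)
  · rintro ⟨x, hx⟩
    exact keyS x (hσT x x.2) c (congrArg Subtype.val hx)

end Uniqueness

/-! ### The main theorem -/

theorem proposition4p8 {F V : Type*} [Field F] [CharP F 2] [AddCommGroup V] [Module F V]
    [FiniteDimensional F V] (q : QuadraticForm F V) (hq : RegularForm q)
    (τ : q.IsometryEquiv q) (hτ : ∀ x, τ (τ x) = x)
    (hrk : QuadIsometry.residual τ = QuadIsometry.fixed τ) :
    (∃ S : Subalgebra F (CliffordAlgebra q), IsPhi (QuadIsometry.cliffordInvolution τ hτ) S) ∧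
    (∀ S : Subalgebra F (CliffordAlgebra q), IsPhi (QuadIsometry.cliffordInvolution τ hτ) S →
      Nonempty (S ≃ₐ[F] CliffordAlgebra (QuadIsometry.wallQuadratic τ))) ∧
    Nonempty (CliffordAlgebra (QuadIsometry.wallQuadratic τ) ≃ₐ[F]
      CliffordAlgebra (QuadIsometry.residualForm τ)) ∧
    TotallySingular (QuadIsometry.wallQuadratic τ) ∧
    (∀ a b : CliffordAlgebra (QuadIsometry.wallQuadratic τ), a * b = b * a) := by
  have hW := QuadIsometry.isPhi_adjoinSubmodule_residual hq τ hτ hrk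
  have hphi := QuadIsometry.wallQuadratic_eq_residualForm τ
  have hsing : TotallySingular (QuadIsometry.wallQuadratic τ) := fun x y => by
    rw [hphi]
    exact QuadIsometry.polar_eq_zero_of_mem_residual hrk x.2 y.2
  obtain ⟨e⟩ := CliffordAlgebra.nonempty_algEquiv_adjoinSubmodule q (QuadIsometry.residual τ)
  refine ⟨⟨_, hW⟩, fun S hS => ?_, ?_, hsing, fun a b => ?_⟩
  · obtain ⟨f⟩ := hS.nonempty_algEquiv (QuadIsometry.one_ne_add_cliffordInvolution τ hτ hrk)
      (fun x y hy h => CliffordAlgebra.eq_zero_of_forall_sum_mul_mul hq hy h) hW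
    rw [hphi]
    exact ⟨f.trans e.symm⟩
  · rw [hphi]
    exact ⟨AlgEquiv.refl⟩
  · have htop : ∀ c : CliffordAlgebra (QuadIsometry.wallQuadratic τ),
        c ∈ CliffordAlgebra.adjoinSubmodule (QuadIsometry.wallQuadratic τ) ⊤ := fun c => by
      rw [CliffordAlgebra.adjoinSubmodule_top]
      exact Algebra.mem_top
    exact CliffordAlgebra.commute_of_mem_adjoinSubmodule (fun u _ v _ => hsing u v)
      (htop a) (htop b)
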